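/- Notation. Let $\mathrm{GMp}_1^+(\mathbb{R})$ be the group of pairs $(\gamma,\omega)$ with $\gamma=\begin{pmatrix}a&b\\c&d\end{pmatrix}\in\mathrm{GL}_2(\mathbb{R})$, $\det\gamma>0$, and $\omega:\mathbb{H}\to\mathbb{C}$ holomorphic with $\omega(\tau)^2=c\tau+d$, with product $(\gamma,\omega)(\gamma',\omega')=(\gamma\gamma',\,(\omega\circ\gamma')\cdot\omega')$. Let $\mathrm{Mp}_1(\mathbb{Z})$, $\widetilde\Gamma_0(N)$, $\widetilde\Gamma(N)$ and $\mathrm{GMp}_1^{(M)}(\mathbb{Z})$ be the preimages of $\mathrm{SL}_2(\mathbb{Z})$, of $\Gamma_0(N)$, of $\Gamma(N)$, and of the set of integral $2\times 2$ matrices of determinant $M$. A subgroup of $\mathrm{Mp}_1(\mathbb{Z})$ is a congruence subgroup of level $N$ if $N$ is the least positive integer such that its image in $\mathrm{SL}_2(\mathbb{Z})$ contains $\Gamma(N)$. Put $T=\big(\begin{pmatrix}1&1\\0&1\end{pmatrix},1\big)$ and $e(z)=\exp(2\pi i z)$. For a complex right module $V$ of $\mathrm{Mp}_1(\mathbb{Z})$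 let $$\mathrm{T}_M V=V\otimes_{\mathbb{C}[\mathrm{Mp}_1(\mathbb{Z})]}\mathbb{C}\big[\mathrm{GMp}_1^{(M)}(\mathbb{Z})\big],$$ where $\mathbb{C}[\mathrm{GMp}_1^{(M)}(\mathbb{Z})]$ has basis $\mathfrak{u}_x$, $x\in\mathrm{GMp}_1^{(M)}(\mathbb{Z})$; it is a right module of $\mathrm{Mp}_1(\mathbb{Z})$ via $(v\otimes\mathfrak{u}_x)\gamma=v\otimes\mathfrak{u}_{x\gamma}$. If $vT=e(\alpha)v$ with $\alpha\in\mathbb{Q}$, put, for $b\in\mathbb{Z}$, $$v_T(M,b;\alpha)=v\otimes\sum_{h\,(\mathrm{mod}\ M)}e\Big(-\frac{(b+\alpha)h}{M}\Big)\,\mathfrak{u}_{\left(\begin{smallmatrix}1&h\\0&M\end{smallmatrix}\right)}\in \mathrm{T}_M V,$$ where $\left(\begin{smallmatrix}1&h\\0&M\end{smallmatrix}\right)$ stands for the pair of this matrix and the constant function $\sqrt{M}$. Proposition. Let $M$ and $N$ be coprime positive integers, and let $V$ be a finite dimensional complex right module of $\mathrm{Mp}_1(\mathbb{Z})$ whose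 kernel in $\mathrm{Mp}_1(\mathbb{Z})$ is a congruence subgroup of level $N$. Let $p\mid M$ be a prime and $M=M_pM_p^\#$ a factorization with $M_p\mid p^4$ and $\gcd(p,M_p^\#)=1$. Let $W\subseteq \mathrm{T}_M V$ be a subrepresentation for $\widetilde\Gamma(M_p^\# N)$. Let $0\neq v\in V$ satisfy $vT=e(\alpha)v$ with $\alpha\in\mathbb{Q}$, and suppose that there is a character $\chi$ of $\widetilde\Gamma_0(N)$ such that $v\gamma=\chi(\gamma)v$ for all $\gamma\in\widetilde\Gamma_0(N)$. If $p\in\{2,3\}$, assume in addition that $M_p$ divides the numerator of $\alpha$ (written in lowest terms). Assume that $v_T(M,b;\alpha)\in W$ for some integer $b\in M_p\mathbb{Z}$. Then $v_T(M,\,b+uM/p;\,\alpha)\in W$ for some $u\in\mathbb{Z}$ coprime to $p$. -/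

import Mathlib

open UpperHalfPlane CongruenceSubgroup
open scoped MatrixGroups TensorProduct

noncomputable section

namespace Metaplectic

/-! ### The metaplectic group -/

/-- The metaplectic double cover of `GL₂⁺(ℝ)`: pairs `(γ, ω)` of `γ = (a b; c d)` with positive
determinant and a continuous function `ω` on the upper half plane with `ω(τ)² = cτ + d`.  As
`cτ + d` is holomorphic without zeros, continuity of `ω` is the same as holomorphy, and there are
exactly two choices of `ω` for each `γ`. -/
@[ext]
structure GMp where
  /-- the underlying matrix -/
  mat : GL(2, ℝ)⁺
  /-- the square root of the automorphy factor -/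
  root : ℍ → ℂ
  continuous_root : Continuous root
  root_sq : ∀ τ : ℍ, root τ ^ 2 = denom (mat : GL (Fin 2) ℝ) τ

namespace GMp

theorem denom_mul (g h : GL(2, ℝ)⁺) (τ : ℍ) :
    denom ((g * h : GL(2, ℝ)⁺) : GL (Fin 2) ℝ) τ =
      denom (g : GL (Fin 2) ℝ) ((h • τ : ℍ) : ℂ) * denom (h : GL (Fin 2) ℝ) τ := by
  have hh : 0 < (h : GL (Fin 2) ℝ).det.val := h.2
  have := denom_cocycle_σ (g : GL (Fin 2) ℝ) (h : GL (Fin 2) ℝ) τ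
  rw [σ, if_pos hh] at this
  simpa using! this

theorem root_ne_zero (x : GMp) (τ : ℍ) : x.root τ ≠ 0 := by
  intro h
  have := x.root_sq τ
  rw [h] at this
  exact denom_ne_zero (x.mat : GL (Fin 2) ℝ) τ (by simpa using this.symm)

theorem continuous_smul_mat (g : GL(2, ℝ)⁺) : Continuous fun τ : ℍ => g • τ :=
  continuous_const_smul (g : GL (Fin 2) ℝ)

/-- `(γ, ω) · (γ', ω') = (γγ', (ω ∘ γ') · ω')`. -/
instance : Mul GMp where
  mul x y :=
    { mat := x.mat * y.mat
      root := fun τ => x.root (y.mat • τ) * y.root τ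
      continuous_root :=
        (x.continuous_root.comp (continuous_smul_mat y.mat)).mul y.continuous_root
      root_sq := fun τ => by
        rw [mul_pow, x.root_sq, y.root_sq, denom_mul] }

instance : One GMp where
  one :=
    { mat := 1
      root := fun _ => 1
      continuous_root := continuous_const
      root_sq := fun τ => by simp }

instance : Inv GMp where
  inv x :=
    { mat := x.mat⁻¹
      root := fun τ => (x.root (x.mat⁻¹ • τ))⁻¹
      continuous_root :=
        (x.continuous_root.comp (continuous_smul_mat x.mat⁻¹)).inv₀ fun _ => x.root_ne_zero _
      root_sq := fun τ => by
        have h := denom_mul x.mat x.mat⁻¹ τ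
        rw [mul_inv_cancel] at h
        rw [inv_pow, x.root_sq, inv_eq_iff_eq_inv]
        refine eq_inv_of_mul_eq_one_left ?_
        rw [← h]
        simp }

@[simp] theorem mul_mat (x y : GMp) : (x * y).mat = x.mat * y.mat := rfl
@[simp] theorem mul_root (x y : GMp) (τ : ℍ) :
    (x * y).root τ = x.root (y.mat • τ) * y.root τ := rfl
@[simp] theorem one_mat : (1 : GMp).mat = 1 := rfl
@[simp] theorem one_root (τ : ℍ) : (1 : GMp).root τ = 1 := rfl
@[simp] theorem inv_mat (x : GMp) : (x⁻¹).mat = x.mat⁻¹ := rfl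
@[simp] theorem inv_root (x : GMp) (τ : ℍ) : (x⁻¹).root τ = (x.root (x.mat⁻¹ • τ))⁻¹ := rfl

instance : Group GMp :=
  Group.ofLeftAxioms
    (fun x y z => GMp.ext (mul_assoc _ _ _) (funext fun τ => by simp [mul_smul, mul_assoc]))
    (fun x => GMp.ext (one_mul _) (funext fun τ => by simp))
    (fun x => GMp.ext (inv_mul_cancel _) (funext fun τ => by
      simp [inv_smul_smul, x.root_ne_zero τ]))

/-- The projection `(γ, ω) ↦ γ`. -/
def proj : GMp →* GL(2, ℝ)⁺ where
  toFun := mat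
  map_one' := rfl
  map_mul' _ _ := rfl

end GMp

/-- The inclusion of `SL₂(ℤ)` into `GL₂⁺(ℝ)`. -/
def incl : SL(2, ℤ) →* GL(2, ℝ)⁺ :=
  Matrix.SpecialLinearGroup.toGLPos.comp (Matrix.SpecialLinearGroup.map (Int.castRingHom ℝ))

/-- The integral metaplectic group `Mp₁(ℤ)`, the preimage of `SL₂(ℤ)`. -/
def MpZ : Subgroup GMp := (incl.range).comap GMp.proj

/-- The preimage `Γ̃` in `Mp₁(ℤ)` of a subgroup `Γ` of `SL₂(ℤ)`. -/
def tilde (Γ : Subgroup SL(2, ℤ)) : Subgroup MpZ :=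
  (Γ.map incl).comap (GMp.proj.comp MpZ.subtype)

/-- The image in `SL₂(ℤ)` of a subgroup of `Mp₁(ℤ)`. -/
def projSL (Δ : Subgroup MpZ) : Subgroup SL(2, ℤ) :=
  (Δ.map (GMp.proj.comp MpZ.subtype)).comap incl

/-- `Δ ⊆ Mp₁(ℤ)` is a congruence subgroup of level `N`: `N` is the least positive integer such
that the image of `Δ` in `SL₂(ℤ)` contains `Γ(N)`. -/
def IsCongruenceOfLevel (Δ : Subgroup MpZ) (N : ℕ) : Prop :=
  IsLeast {n : ℕ | 0 < n ∧ Gamma n ≤ projSL Δ} N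

/-- The element `T = ((1 1; 0 1), 1)` of `Mp₁(ℤ)`. -/
def T : MpZ :=
  ⟨{ mat := incl ModularGroup.T
     root := fun _ => 1
     continuous_root := continuous_const
     root_sq := fun τ => by
      have h : denom (incl ModularGroup.T : GL (Fin 2) ℝ) τ =
          (((ModularGroup.T.1 1 0 : ℤ) : ℝ) : ℂ) * τ + (((ModularGroup.T.1 1 1 : ℤ) : ℝ) : ℂ) := rfl
      rw [h]
      simp [ModularGroup.T] }, ⟨ModularGroup.T, rfl⟩⟩

/-! ### The bimodule spanned by integral matrices of determinant `M` -/

/-- `x` lies over an integral matrix of determinant `M`. -/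
def IsIntegralOfDet (M : ℕ) (x : GMp) : Prop :=
  ∃ A : Matrix (Fin 2) (Fin 2) ℤ, A.det = M ∧
    ((x.mat : GL (Fin 2) ℝ) : Matrix (Fin 2) (Fin 2) ℝ) = A.map (Int.cast : ℤ → ℝ)

/-- The preimage `GMp₁^(M)(ℤ)` of the set of integral matrices of determinant `M`. -/
abbrev GMpDet (M : ℕ) : Type := {x : GMp // IsIntegralOfDet M x}

theorem isIntegralOfDet_one (g : MpZ) : IsIntegralOfDet 1 (g : GMp) := by
  obtain ⟨s, hs⟩ := g.2
  refine ⟨s.1, by simp, ?_⟩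
  rw [show (g : GMp).mat = incl s from hs.symm]
  rfl

theorem IsIntegralOfDet.mul {M M' : ℕ} {x y : GMp} (hx : IsIntegralOfDet M x)
    (hy : IsIntegralOfDet M' y) : IsIntegralOfDet (M * M') (x * y) := by
  obtain ⟨A, hA, hxA⟩ := hx
  obtain ⟨B, hB, hyB⟩ := hy
  refine ⟨A * B, by simp [hA, hB], ?_⟩
  have h := Matrix.map_mul (L := A) (M := B) (f := Int.castRingHom ℝ)
  simp only [Int.coe_castRingHom] at h
  rw [h, ← hxA, ← hyB]
  simp

/-- Left multiplication of `GMp₁^(M)(ℤ)` by `Mp₁(ℤ)`. -/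
def lmul {M : ℕ} (g : MpZ) (x : GMpDet M) : GMpDet M :=
  ⟨(g : GMp) * x.1, by simpa using (isIntegralOfDet_one g).mul x.2⟩

/-- Right multiplication of `GMp₁^(M)(ℤ)` by `Mp₁(ℤ)`. -/
def rmul {M : ℕ} (x : GMpDet M) (g : MpZ) : GMpDet M :=
  ⟨x.1 * (g : GMp), by simpa using x.2.mul (isIntegralOfDet_one g)⟩

/-- The upper triangular matrix `(1 h; 0 M)` as an element of `GMp₁^(M)(ℤ)`, with second
component the constant function `√M`. -/
def upper (M : ℕ) [NeZero M] (h : ℤ) : GMpDet M :=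
  ⟨{ mat := ⟨Matrix.GeneralLinearGroup.mkOfDetNeZero !![(1 : ℝ), h; 0, M]
        (by simpa [Matrix.det_fin_two] using NeZero.ne M), by
          rw [Matrix.mem_glpos]
          simpa [Matrix.GeneralLinearGroup.mkOfDetNeZero, Matrix.det_fin_two] using
            Nat.pos_of_ne_zero (NeZero.ne M)⟩
     root := fun _ => (Real.sqrt M : ℂ)
     continuous_root := continuous_const
     root_sq := fun τ => by
      have h1 : ((Real.sqrt M : ℝ) : ℂ) ^ 2 = (M : ℂ) := by
        rw [← Complex.ofReal_pow, Real.sq_sqrt (Nat.cast_nonneg M)]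
        simp
      simp [denom, Matrix.GeneralLinearGroup.mkOfDetNeZero, h1] },
    ⟨!![1, h; 0, M], by simp [Matrix.det_fin_two], by
      ext i j
      fin_cases i <;> fin_cases j <;>
        simp [Matrix.GeneralLinearGroup.mkOfDetNeZero]⟩⟩

/-! ### Hecke operators on right modules

A complex right module of `Mp₁(ℤ)` is given as a representation `ρ` of the opposite group, the
vector `vγ` being `ρ (op γ) v`. -/

variable {V : Type*} [AddCommGroup V] [Module ℂ V]

/-- The kernel in `Mp₁(ℤ)` of a right module. -/
def kernel (ρ : Representation ℂ (MpZ)ᵐᵒᵖ V) : Subgroup MpZ where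
  carrier := {g | ∀ v : V, ρ (MulOpposite.op g) v = v}
  one_mem' v := by simp
  mul_mem' {a b} ha hb v := by
    rw [MulOpposite.op_mul, map_mul, Module.End.mul_apply, ha, hb]
  inv_mem' {a} ha v := by
    conv_lhs => rw [← ha v]
    rw [← Module.End.mul_apply, ← map_mul, ← MulOpposite.op_mul, mul_inv_cancel]
    simp

/-- The relations `vg ⊗ u_x = v ⊗ u_{gx}`, with `g ∈ Mp₁(ℤ)`, defining the tensor product over
`ℂ[Mp₁(ℤ)]` as a quotient of the tensor product over `ℂ`. -/
def heckeRelations (ρ : Representation ℂ (MpZ)ᵐᵒᵖ V) (M : ℕ) :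
    Submodule ℂ (V ⊗[ℂ] (GMpDet M →₀ ℂ)) :=
  Submodule.span ℂ {z | ∃ (g : MpZ) (v : V) (x : GMpDet M),
    z = ρ (MulOpposite.op g) v ⊗ₜ[ℂ] Finsupp.single x 1 - v ⊗ₜ[ℂ] Finsupp.single (lmul g x) 1}

/-- The underlying space of `T_M V = V ⊗_{ℂ[Mp₁(ℤ)]} ℂ[GMp₁^(M)(ℤ)]`. -/
abbrev Hecke (ρ : Representation ℂ (MpZ)ᵐᵒᵖ V) (M : ℕ) : Type _ :=
  (V ⊗[ℂ] (GMpDet M →₀ ℂ)) ⧸ heckeRelations ρ M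

/-- Right multiplication by `g` on `V ⊗ ℂ[GMp₁^(M)(ℤ)]`, which sends `v ⊗ u_x` to
`v ⊗ u_{xg}`. -/
def preAction (V : Type*) [AddCommGroup V] [Module ℂ V] (M : ℕ) (g : MpZ) :
    Module.End ℂ (V ⊗[ℂ] (GMpDet M →₀ ℂ)) :=
  TensorProduct.map LinearMap.id (Finsupp.lmapDomain ℂ ℂ fun x => rmul x g)

theorem preAction_tmul_single (M : ℕ) (g : MpZ) (v : V) (x : GMpDet M) (c : ℂ) :
    preAction V M g (v ⊗ₜ[ℂ] Finsupp.single x c) = v ⊗ₜ[ℂ] Finsupp.single (rmul x g) c := by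
  simp [preAction, Finsupp.mapDomain_single]

theorem heckeRelations_le_comap (ρ : Representation ℂ (MpZ)ᵐᵒᵖ V) (M : ℕ) (g : MpZ) :
    heckeRelations ρ M ≤ (heckeRelations ρ M).comap (preAction V M g) := by
  rw [heckeRelations, Submodule.span_le]
  rintro _ ⟨k, v, x, rfl⟩
  refine Submodule.subset_span ⟨k, v, rmul x g, ?_⟩
  have h : rmul (lmul k x) g = lmul k (rmul x g) := Subtype.ext (mul_assoc _ _ _)
  rw [map_sub, preAction_tmul_single, preAction_tmul_single, h]

/-- The right action of `Mp₁(ℤ)` on `T_M V`, `(v ⊗ u_x) g = v ⊗ u_{xg}`. -/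
def heckeRep (ρ : Representation ℂ (MpZ)ᵐᵒᵖ V) (M : ℕ) :
    Representation ℂ (MpZ)ᵐᵒᵖ (Hecke ρ M) where
  toFun g := (heckeRelations ρ M).mapQ (heckeRelations ρ M) (preAction V M g.unop)
    (heckeRelations_le_comap ρ M g.unop)
  map_one' := by
    have h : (fun x : GMpDet M => rmul x 1) = id := funext fun x => Subtype.ext (mul_one _)
    have h' : preAction V M 1 = LinearMap.id := by
      rw [preAction, h, Finsupp.lmapDomain_id, TensorProduct.map_id]
    refine Submodule.linearMap_qext _ (LinearMap.ext fun z => ?_)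
    simp [h']
  map_mul' a b := by
    have h : (fun x : GMpDet M => rmul x (b.unop * a.unop)) =
        (fun x => rmul x a.unop) ∘ fun x => rmul x b.unop :=
      funext fun x => Subtype.ext (mul_assoc _ _ _).symm
    have h' : preAction V M (b.unop * a.unop) = preAction V M a.unop ∘ₗ preAction V M b.unop := by
      rw [preAction, h, Finsupp.lmapDomain_comp, preAction, preAction, ← TensorProduct.map_comp,
        LinearMap.id_comp]
    refine Submodule.linearMap_qext _ (LinearMap.ext fun z => ?_)
    simp [h']

/-- `e(z) = exp(2πiz)` at a rational number. -/
def e (r : ℚ) : ℂ := Complex.exp (2 * Real.pi * Complex.I * (r : ℂ))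

/-- `v_T(M, b; α) = v ⊗ ∑_{h mod M} e(-(b + α)h / M) u_{(1 h; 0 M)}` in `T_M V`. -/
def vT (ρ : Representation ℂ (MpZ)ᵐᵒᵖ V) (M : ℕ) [NeZero M] (b : ℤ) (α : ℚ) (v : V) :
    Hecke ρ M :=
  (heckeRelations ρ M).mkQ
    (v ⊗ₜ[ℂ] ∑ h ∈ Finset.range M,
      Finsupp.single (upper M (h : ℤ)) (e (-((b + α) * h / M))))

end Metaplectic

end

/-!
Write `f_h` for the class of `v ⊗ u_{(1 h; 0 M)}`.  Then `f_h T = f_{h+1}`, and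
`f_{h+M} = e(α) f_h`.

**Reduction to signs.**  The preimage of `Γ(N)` acts on `v` by signs, as its elements agree with
elements of the kernel up to the central element `z = (1, -1)`.  If `N` is odd, then `z` itself acts
trivially (`Metaplectic.zc_mem_kernel`); so either no signs occur, or `N` is even and `M` is odd.
Replacing `N` by `2N` in the second case, `T^N` fixes `v`, and `αN` is an integer.  Among the
multiples `h` of `N`, the vector `f_h` now depends only on `h` modulo `M`.  This gives nonzero vectors
`F x` for `x ∈ ℤ/Mℤ`, which the preimage of `Γ(N)` permutes up to signs through its action on the
projective line over `ℤ/Mℤ`, as long as no point is moved to infinity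
(`SignedAction`, `Metaplectic.signedAction`).  The vector `v_T(M, b; α)` becomes `∑ ψ(x) F x` for an
additive character `ψ` of `ℤ/Mℤ` (`Metaplectic.vT_eq`), and replacing `b` by `b + uM/p` with `u` prime
to `p` amounts to multiplying `ψ` by a character of order `p`.  As `Mp ∣ b`, the hypothesis for
`p = 2, 3` says that `ψ` is trivial on the multiples of `Ms`.

**Twisting.**  It remains to see that `W` contains such a twist of `∑ ψ(x) F x`
(`SignedAction.exists_twist_mem`).  The preimage of `Γ(MN)` fixes all points and acts on `F x` through
signs.  Let `R ⊆ ℤ/Mℤ` be the group of periods of these signs.  Points in different cosets of `R` are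
told apart by the signs, so coefficients may be multiplied by any function constant on the cosets of
`R` (`SignedAction.sum_mul_mem`).

* If `R` lies in the multiples of `p`, every character of order `p` is such a function.
* Otherwise `R` contains all multiples of `Ms`.  If `ψ` is nontrivial on these, then `p ≥ 5`, and
  an element congruent to `diag(A, A⁻¹)` modulo `MN` and to `1` modulo `Ms N` turns `ψ` into
  `x ↦ ψ(A²x)` (`SignedAction.sum_mul_sq_mem`).  With a suitable `A` the quotient of the two has order
  `p`.
* If `ψ` is trivial on the multiples of `Ms`, an element `γ` antidiagonal modulo `p` and congruent
  to `1` modulo `Ms N` is applied.  It moves the points `x ≡ 0` modulo `p` to infinity, and their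
  contribution becomes invariant under translations by multiples of `Ms N`.  Projecting to a
  nontrivial character of the translations removes this part.  What is left is a twist of
  `∑ ψ(x) F x`, multiplied by a Fourier coefficient of a function on `ℤ/pℤ` that is zero at `0` and
  `±1` elsewhere; such a coefficient is not zero (`SignedAction.sum_coset_twist_mem`).

The last two points need that certain elements act on the cosets of `R` with a constant sign.  If
signs occur, `M` is odd.  The product of the signs over a coset, which has odd order, is multiplicative
in the element, and an element whose `M`-th power lies over `Γ(MN)` has the same product as this
power, which has a constant sign by the definition of `R` (`SignedAction.sgn_eq_sgn_pow`).
-/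

/-! ### Integral matrices acting on the affine line over `ℤ/Mℤ` -/

section AffineLine

variable (M : ℕ)

/-- The first coordinate of the row `(1, x) s` over `ℤ/Mℤ`. -/
def rowDen (s : SL(2, ℤ)) (x : ZMod M) : ZMod M := (s 0 0 : ZMod M) + (s 1 0 : ZMod M) * x

/-- The second coordinate of the row `(1, x) s` over `ℤ/Mℤ`. -/
def rowNum (s : SL(2, ℤ)) (x : ZMod M) : ZMod M := (s 0 1 : ZMod M) + (s 1 1 : ZMod M) * x

/-- The right action of `SL₂(ℤ)` on the affine part of the projective line over `ℤ/Mℤ`: the row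
`(1, x) s` is proportional to `(1, move s x)`.  It is meaningful only when `rowDen M s x` is a
unit. -/
def move (s : SL(2, ℤ)) (x : ZMod M) : ZMod M := rowNum M s x * (rowDen M s x)⁻¹

variable {M}

theorem SL2_det (s : SL(2, ℤ)) : s 0 0 * s 1 1 - s 0 1 * s 1 0 = 1 := by
  have := s.det_coe
  rwa [Matrix.det_fin_two] at this

theorem SL2_det_cast (s : SL(2, ℤ)) (R : Type*) [CommRing R] :
    (s 0 0 : R) * (s 1 1 : R) - (s 0 1 : R) * (s 1 0 : R) = 1 := by
  exact_mod_cast congrArg (Int.cast : ℤ → R) (SL2_det s)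

theorem SL2_mul_apply (s t : SL(2, ℤ)) (i j : Fin 2) :
    (s * t) i j = s i 0 * t 0 j + s i 1 * t 1 j := by
  rw [Matrix.SpecialLinearGroup.coe_mul, Matrix.mul_apply, Fin.sum_univ_two]

theorem rowDen_mul_move {s : SL(2, ℤ)} {x : ZMod M} (h : IsUnit (rowDen M s x)) :
    rowDen M s x * move M s x = rowNum M s x := by
  rw [move, mul_left_comm, ZMod.mul_inv_of_unit _ h, mul_one]

theorem move_eq {s : SL(2, ℤ)} {x y : ZMod M} (h : IsUnit (rowDen M s x))
    (hy : rowDen M s x * y = rowNum M s x) : move M s x = y :=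
  h.mul_left_cancel ((rowDen_mul_move h).trans hy.symm)

theorem rowDen_mul {s : SL(2, ℤ)} {x : ZMod M} (h : IsUnit (rowDen M s x)) (t : SL(2, ℤ)) :
    rowDen M (s * t) x = rowDen M s x * rowDen M t (move M s x) := by
  have := rowDen_mul_move h
  simp only [rowDen, rowNum, SL2_mul_apply] at *
  push_cast
  linear_combination (-(t 1 0 : ZMod M)) * this

theorem rowNum_mul {s : SL(2, ℤ)} {x : ZMod M} (h : IsUnit (rowDen M s x)) (t : SL(2, ℤ)) :
    rowNum M (s * t) x = rowDen M s x * rowNum M t (move M s x) := by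
  have := rowDen_mul_move h
  simp only [rowDen, rowNum, SL2_mul_apply] at *
  push_cast
  linear_combination (-(t 1 1 : ZMod M)) * this

theorem move_mul {s t : SL(2, ℤ)} {x : ZMod M} (h : IsUnit (rowDen M s x))
    (h' : IsUnit (rowDen M t (move M s x))) : move M (s * t) x = move M t (move M s x) := by
  refine move_eq ?_ ?_
  · rw [rowDen_mul h]; exact h.mul h'
  · rw [rowDen_mul h, rowNum_mul h, mul_assoc, rowDen_mul_move h']

theorem move_injective {s : SL(2, ℤ)} {x y : ZMod M} (hx : IsUnit (rowDen M s x))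
    (hy : IsUnit (rowDen M s y)) (h : move M s x = move M s y) : x = y := by
  have h1 := rowDen_mul_move hx
  have h2 := rowDen_mul_move hy
  rw [← h] at h2
  have h3 : rowDen M s y * rowNum M s x = rowDen M s x * rowNum M s y := by
    rw [← h1, ← h2]; ring
  have := SL2_det_cast s (ZMod M)
  simp only [rowDen, rowNum] at h3
  linear_combination h3 - (x - y) * this

theorem Gamma_mono {m n : ℕ} (h : m ∣ n) : Gamma n ≤ Gamma m := by
  intro s hs
  rw [Gamma_mem] at hs ⊢
  have key : ∀ a b : ℤ, (a : ZMod n) = b → (a : ZMod m) = b := fun a b hab => by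
    rw [ZMod.intCast_eq_intCast_iff_dvd_sub] at hab ⊢
    exact (Int.natCast_dvd_natCast.2 h).trans hab
  refine ⟨?_, ?_, ?_, ?_⟩
  · simpa using key _ 1 (by simpa using hs.1)
  · simpa using key _ 0 (by simpa using hs.2.1)
  · simpa using key _ 0 (by simpa using hs.2.2.1)
  · simpa using key _ 1 (by simpa using hs.2.2.2)

theorem rowDen_of_mem_Gamma {s : SL(2, ℤ)} (hs : s ∈ Gamma M) (x : ZMod M) :
    rowDen M s x = 1 := by
  rw [Gamma_mem] at hs
  simp [rowDen, hs.1, hs.2.2.1]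

theorem move_of_mem_Gamma {s : SL(2, ℤ)} (hs : s ∈ Gamma M) (x : ZMod M) : move M s x = x := by
  have h := rowDen_of_mem_Gamma hs x
  refine move_eq (by simp [h]) ?_
  rw [h]
  rw [Gamma_mem] at hs
  simp [rowNum, hs.2.1, hs.2.2.2]

/-- The unipotent matrix `(1 n; 0 1)`. -/
def transl (n : ℤ) : SL(2, ℤ) := ⟨!![1, n; 0, 1], by simp [Matrix.det_fin_two]⟩

@[simp] theorem transl_00 (n : ℤ) : transl n 0 0 = 1 := rfl
@[simp] theorem transl_01 (n : ℤ) : transl n 0 1 = n := rfl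
@[simp] theorem transl_10 (n : ℤ) : transl n 1 0 = 0 := rfl
@[simp] theorem transl_11 (n : ℤ) : transl n 1 1 = 1 := rfl

theorem transl_add (m n : ℤ) : transl (m + n) = transl m * transl n := by
  ext i j
  rw [SL2_mul_apply]
  fin_cases i <;> fin_cases j <;> simp [add_comm]

theorem transl_zero : transl 0 = 1 := by
  ext i j
  fin_cases i <;> fin_cases j <;> simp [transl]

theorem transl_pow (n : ℤ) (m : ℕ) : transl n ^ m = transl (m * n) := by
  induction m with
  | zero => simp [transl_zero]
  | succ m ih => rw [pow_succ, ih, ← transl_add]; push_cast; ring_nf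

theorem transl_mem_Gamma {n : ℕ} {a : ℤ} (h : (n : ℤ) ∣ a) : transl a ∈ Gamma n := by
  rw [Gamma_mem]
  simpa using (ZMod.intCast_zmod_eq_zero_iff_dvd a n).2 h

theorem rowDen_transl (n : ℤ) (x : ZMod M) : rowDen M (transl n) x = 1 := by simp [rowDen]

theorem move_transl (n : ℤ) (x : ZMod M) : move M (transl n) x = x + n :=
  move_eq (by simp [rowDen_transl]) (by simp [rowDen_transl, rowNum, add_comm])

end AffineLine

/-! ### Signed actions on the affine line -/

/-- A right action of a group `G` over `SL₂(ℤ)` on a complex vector space, together with nonzero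
vectors `F x` indexed by the affine line over `ℤ/Mℤ` which the preimage of `Γ(N)` permutes up to
signs, as long as they stay in the affine line.  A fixed element `tr` over `(1 N; 0 1)` permutes
them without signs. -/
structure SignedAction (M N : ℕ) (G U : Type*) [Group G] [AddCommGroup U] [Module ℂ U] where
  /-- the underlying matrix -/
  mat : G →* SL(2, ℤ)
  mat_surjective : Function.Surjective mat
  /-- the right action, written as a representation of the opposite group -/
  rep : Representation ℂ Gᵐᵒᵖ U
  /-- the family of vectors -/
  F : ZMod M → U
  F_ne_zero : ∀ x, F x ≠ 0
  /-- the distinguished translation -/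
  tr : G
  mat_tr : mat tr = transl N
  tr_F : ∀ x, rep (MulOpposite.op tr) (F x) = F (x + N)
  sign_F : ∀ g, mat g ∈ Gamma N → ∀ x y, IsUnit (rowDen M (mat g) x) →
    rowDen M (mat g) x * y = rowNum M (mat g) x →
      rep (MulOpposite.op g) (F x) = F y ∨ rep (MulOpposite.op g) (F x) = -F y

namespace SignedAction

variable {M N : ℕ} {G U : Type*} [Group G] [AddCommGroup U] [Module ℂ U]
  (D : SignedAction M N G U)

/-- The right action of a group element. -/
def act (g : G) : U →ₗ[ℂ] U := D.rep (MulOpposite.op g)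

theorem act_mul (g h : G) (u : U) : D.act (g * h) u = D.act h (D.act g u) := by
  simp [act, MulOpposite.op_mul, map_mul]

theorem act_one (u : U) : D.act 1 u = u := by simp [act]

theorem act_inv_act (g : G) (u : U) : D.act g⁻¹ (D.act g u) = u := by
  rw [← act_mul, mul_inv_cancel, act_one]

/-- `g` lies over `Γ(N)` and moves the point `x` to a point of the affine line. -/
def Adm (g : G) (x : ZMod M) : Prop := D.mat g ∈ Gamma N ∧ IsUnit (rowDen M (D.mat g) x)

/-- The image of the affine point `x` under `g`. -/
def mv (g : G) (x : ZMod M) : ZMod M := move M (D.mat g) x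

open Classical in
/-- The sign with which `g` sends `F x` to `F (mv g x)`. -/
noncomputable def sgn (g : G) (x : ZMod M) : ℤˣ :=
  if D.act g (D.F x) = D.F (D.mv g x) then 1 else -1

variable {D}

theorem Adm.act_F {g : G} {x : ZMod M} (h : D.Adm g x) :
    D.act g (D.F x) = ((D.sgn g x : ℤ) : ℂ) • D.F (D.mv g x) := by
  unfold sgn
  split_ifs with h1
  · simpa using h1
  · have := (D.sign_F g h.1 x (D.mv g x) h.2 (rowDen_mul_move h.2)).resolve_left h1
    simpa [act] using this

theorem sgn_eq_of_smul {u : ℤˣ} {g : G} {x y : ZMod M} (h : D.Adm g x) (hy : D.mv g x = y)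
    (hu : D.act g (D.F x) = ((u : ℤ) : ℂ) • D.F y) : D.sgn g x = u := by
  rw [h.act_F, hy] at hu
  have := smul_left_injective ℂ (D.F_ne_zero y) hu
  exact Units.ext (by exact_mod_cast this)

theorem Adm.mul {g k : G} {x : ZMod M} (h : D.Adm g x) (h' : D.Adm k (D.mv g x)) :
    D.Adm (g * k) x := by
  refine ⟨by rw [map_mul]; exact mul_mem h.1 h'.1, ?_⟩
  rw [map_mul, rowDen_mul h.2]
  exact h.2.mul h'.2

theorem mv_mul {g k : G} {x : ZMod M} (h : D.Adm g x) (h' : D.Adm k (D.mv g x)) :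
    D.mv (g * k) x = D.mv k (D.mv g x) := by
  unfold mv
  rw [map_mul, move_mul h.2 h'.2]

theorem sgn_mul {g k : G} {x : ZMod M} (h : D.Adm g x) (h' : D.Adm k (D.mv g x)) :
    D.sgn (g * k) x = D.sgn g x * D.sgn k (D.mv g x) := by
  refine sgn_eq_of_smul (h.mul h') (mv_mul h h') ?_
  rw [act_mul, h.act_F, map_smul, h'.act_F, smul_smul]
  push_cast
  rfl

theorem mat_tr_pow (m : ℕ) : D.mat (D.tr ^ m) = transl (m * N) := by
  rw [map_pow, D.mat_tr, transl_pow]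

theorem tr_pow_F (m : ℕ) (x : ZMod M) : D.act (D.tr ^ m) (D.F x) = D.F (x + m * N) := by
  induction m with
  | zero => simp [act_one]
  | succ m ih =>
    rw [pow_succ, act_mul, ih]
    refine (D.tr_F _).trans ?_
    push_cast
    ring_nf

theorem adm_tr_pow (m : ℕ) (x : ZMod M) : D.Adm (D.tr ^ m) x := by
  rw [Adm, mat_tr_pow, rowDen_transl]
  exact ⟨transl_mem_Gamma (Dvd.intro_left _ rfl), isUnit_one⟩

theorem mv_tr_pow (m : ℕ) (x : ZMod M) : D.mv (D.tr ^ m) x = x + m * N := by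
  rw [mv, mat_tr_pow, move_transl]; push_cast; rfl

theorem sgn_tr_pow (m : ℕ) (x : ZMod M) : D.sgn (D.tr ^ m) x = 1 :=
  sgn_eq_of_smul (adm_tr_pow m x) (mv_tr_pow m x) (by simp [tr_pow_F])

theorem adm_of_mem {g : G} (h : D.mat g ∈ Gamma (M * N)) (x : ZMod M) : D.Adm g x := by
  refine ⟨Gamma_mono (Dvd.intro_left _ rfl) h, ?_⟩
  rw [rowDen_of_mem_Gamma (Gamma_mono (Dvd.intro _ rfl) h)]
  exact isUnit_one

theorem mv_of_mem {g : G} (h : D.mat g ∈ Gamma (M * N)) (x : ZMod M) : D.mv g x = x :=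
  move_of_mem_Gamma (Gamma_mono (Dvd.intro _ rfl) h) x

theorem act_F_of_mem {g : G} (h : D.mat g ∈ Gamma (M * N)) (x : ZMod M) :
    D.act g (D.F x) = ((D.sgn g x : ℤ) : ℂ) • D.F x := by
  rw [(adm_of_mem h x).act_F, mv_of_mem h]

theorem conj_mem {g : G} {n : ℕ} (h : D.mat g ∈ Gamma n) (k : G) :
    D.mat (k * g * k⁻¹) ∈ Gamma n := by
  rw [map_mul, map_mul, map_inv]
  exact (Gamma_normal n).conj_mem _ h _

theorem conj_mem' {g : G} {n : ℕ} (h : D.mat g ∈ Gamma n) (k : G) :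
    D.mat (k⁻¹ * g * k) ∈ Gamma n := by
  simpa using conj_mem (D := D) h k⁻¹

/-- The signs of an element `κ` over `Γ(MN)` and of its conjugate by `k` agree along `k`. -/
theorem sgn_conj_eq {κ k : G} (h : D.mat κ ∈ Gamma (M * N)) {x : ZMod M} (hk : D.Adm k x) :
    D.sgn (k * κ * k⁻¹) x = D.sgn κ (D.mv k x) := by
  have h' := conj_mem (D := D) h k
  refine sgn_eq_of_smul (adm_of_mem h' x) (mv_of_mem h' x) ?_
  rw [act_mul, act_mul, hk.act_F, map_smul, act_F_of_mem h, smul_comm, map_smul, ← hk.act_F,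
    act_inv_act]

/-! ### Splitting along the characters of the principal congruence subgroup -/

variable (D) in
/-- The periods of the signs with which the preimage of `Γ(MN)` acts on the vectors `F x`. -/
def periods : AddSubgroup (ZMod M) where
  carrier := {n | ∀ x κ, D.mat κ ∈ Gamma (M * N) → D.sgn κ (x + n) = D.sgn κ x}
  zero_mem' := by simp
  add_mem' {a b} ha hb x κ hκ := by rw [← add_assoc, hb _ _ hκ, ha _ _ hκ]
  neg_mem' {a} ha x κ hκ := by
    rw [← ha _ _ hκ, neg_add_cancel_right]

theorem sgn_add_of_mem_periods {n : ZMod M} (hn : n ∈ D.periods) {κ : G}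
    (hκ : D.mat κ ∈ Gamma (M * N)) (x : ZMod M) : D.sgn κ (x + n) = D.sgn κ x := hn x κ hκ

theorem exists_mul_eq [NeZero M] (hMN : M.Coprime N) (z : ZMod M) :
    ∃ m : ℕ, (m : ZMod M) * N = z := by
  refine ⟨(z * (N : ZMod M)⁻¹).val, ?_⟩
  rw [ZMod.natCast_zmod_val, mul_assoc, mul_comm (_⁻¹), ZMod.coe_mul_inv_eq_one _ hMN.symm, mul_one]

/-- As translations normalise the preimage of `Γ(MN)`, two points with the same signs differ by a
period. -/
theorem sub_mem_periods [NeZero M] (hMN : M.Coprime N) {x y : ZMod M}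
    (h : ∀ κ, D.mat κ ∈ Gamma (M * N) → D.sgn κ x = D.sgn κ y) : y - x ∈ D.periods := by
  intro z κ hκ
  obtain ⟨m, hm⟩ := exists_mul_eq hMN (z - x)
  have e1 : z + (y - x) = D.mv (D.tr ^ m) y := by rw [mv_tr_pow, hm]; ring
  have e2 : z = D.mv (D.tr ^ m) x := by rw [mv_tr_pow, hm]; ring
  rw [e1, ← sgn_conj_eq hκ (adm_tr_pow m y), ← h _ (conj_mem hκ _),
    sgn_conj_eq hκ (adm_tr_pow m x), ← e2]

variable (D) in
/-- `W` is stable under the preimage of `Γ(n)`. -/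
def Stable (n : ℕ) (W : Submodule ℂ U) : Prop :=
  ∀ g, D.mat g ∈ Gamma n → ∀ w ∈ W, D.act g w ∈ W

theorem Stable.mono {m n : ℕ} {W : Submodule ℂ U} (h : D.Stable m W) (hmn : m ∣ n) :
    D.Stable n W := fun g hg w hw => h g (Gamma_mono hmn hg) w hw

variable [NeZero M]

/-- In an element of `W`, the coefficients at points with other signs than those of `x₀` may be
replaced by zero: one at a time, they are removed by projecting to an eigenspace of an element over
`Γ(MN)`. -/
theorem exists_cutoff {W : Submodule ℂ U} (hW : D.Stable (M * N) W) (hMN : M.Coprime N)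
    {a : ZMod M → ℂ} (ha : ∑ x, a x • D.F x ∈ W) (x₀ : ZMod M) (Y : Finset (ZMod M))
    (hY : ∀ y ∈ Y, y - x₀ ∉ D.periods) :
    ∃ a' : ZMod M → ℂ, (∀ x, x - x₀ ∈ D.periods → a' x = a x) ∧ (∀ y ∈ Y, a' y = 0) ∧
      ∑ x, a' x • D.F x ∈ W := by
  classical
  induction Y using Finset.induction_on with
  | empty => exact ⟨a, fun _ _ => rfl, by simp, ha⟩
  | insert y Y _ ih =>
    obtain ⟨a', h1, h2, h4⟩ := ih fun z hz => hY z (Finset.mem_insert_of_mem hz)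
    have hy : ∃ κ, D.mat κ ∈ Gamma (M * N) ∧ D.sgn κ x₀ ≠ D.sgn κ y := by
      by_contra! hcon
      exact hY y (Finset.mem_insert_self _ _) (sub_mem_periods hMN hcon)
    obtain ⟨κ, hκ, hne⟩ := hy
    -- the average of the identity and of `κ` times its sign at `x₀`
    let s : ZMod M → ℂ := fun x => (1 + ((D.sgn κ x₀ : ℤ) : ℂ) * ((D.sgn κ x : ℤ) : ℂ)) / 2
    have hs : ∀ x, D.sgn κ x = D.sgn κ x₀ → s x = 1 := fun x hx => by
      simp only [s, hx]
      rcases Int.units_eq_one_or (D.sgn κ x₀) with h | h <;> simp [h]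
    have hs0 : ∀ x, D.sgn κ x₀ ≠ D.sgn κ x → s x = 0 := fun x hx => by
      simp only [s]
      rcases Int.units_eq_one_or (D.sgn κ x₀) with h | h <;>
        rcases Int.units_eq_one_or (D.sgn κ x) with h' | h' <;> simp_all
    refine ⟨fun x => s x * a' x, fun x hx => ?_, fun z hz => ?_, ?_⟩
    · show s x * a' x = a x
      rw [hs x, h1 x hx, one_mul]
      simpa using sgn_add_of_mem_periods hx hκ x₀
    · rcases Finset.mem_insert.1 hz with rfl | hz
      · simp [hs0 _ hne]
      · simp [h2 z hz]
    · have : ∑ x, (s x * a' x) • D.F x = (1 / 2 : ℂ) • (∑ x, a' x • D.F x) +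
          ((1 / 2 : ℂ) * ((D.sgn κ x₀ : ℤ) : ℂ)) • D.act κ (∑ x, a' x • D.F x) := by
        rw [map_sum, Finset.smul_sum, Finset.smul_sum, ← Finset.sum_add_distrib]
        refine Finset.sum_congr rfl fun x _ => ?_
        rw [map_smul, act_F_of_mem hκ, smul_smul, smul_smul, smul_smul, ← add_smul]
        congr 1
        simp only [s]
        ring
      rw [this]
      exact W.add_mem (W.smul_mem _ h4) (W.smul_mem _ (hW κ hκ _ h4))

open Classical in
/-- `W` contains the part of each of its elements that is supported on a coset of the periods. -/
theorem sum_coset_mem {W : Submodule ℂ U} (hW : D.Stable (M * N) W) (hMN : M.Coprime N)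
    {a : ZMod M → ℂ} (ha : ∑ x, a x • D.F x ∈ W) (x₀ : ZMod M) :
    ∑ x, (if x - x₀ ∈ D.periods then a x else 0) • D.F x ∈ W := by
  obtain ⟨a', h1, h2, h4⟩ := exists_cutoff hW hMN ha x₀
    (Finset.univ.filter fun y => y - x₀ ∉ D.periods) (by simp)
  convert h4 using 3 with x
  split_ifs with h
  · exact (h1 x h).symm
  · exact (h2 x (by simpa using h)).symm

open Classical in
/-- An element lies in `W` if its parts supported on the cosets of a subgroup do. -/
theorem mem_of_sum_coset_mem {W : Submodule ℂ U} {a : ZMod M → ℂ} (R : AddSubgroup (ZMod M))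
    (h : ∀ x₀, ∑ x, (if x - x₀ ∈ R then a x else 0) • D.F x ∈ W) :
    ∑ x, a x • D.F x ∈ W := by
  let r : ℂ := ((Finset.univ.filter fun y : ZMod M => y ∈ R).card : ℂ)
  have hr : r ≠ 0 := by
    have : 0 < (Finset.univ.filter fun y : ZMod M => y ∈ R).card :=
      Finset.card_pos.2 ⟨0, by simp [R.zero_mem]⟩
    exact Nat.cast_ne_zero.2 this.ne'
  have key : ∑ x₀, ∑ x, (if x - x₀ ∈ R then a x else 0) • D.F x = r • ∑ x, a x • D.F x := by
    rw [Finset.sum_comm, Finset.smul_sum]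
    refine Finset.sum_congr rfl fun x _ => ?_
    rw [← Finset.sum_smul, smul_smul]
    congr 1
    rw [← Finset.sum_filter, Finset.sum_const, nsmul_eq_mul]
    congr 2
    refine Finset.card_bij' (fun y _ => x - y) (fun y _ => x - y) ?_ ?_ ?_ ?_ <;> simp
  have := W.smul_mem r⁻¹ (key ▸ W.sum_mem fun x₀ _ => h x₀)
  rwa [smul_smul, inv_mul_cancel₀ hr, one_smul] at this

/-- The coefficients of an element of `W` may be multiplied by any function that is constant on the
cosets of the periods. -/
theorem sum_mul_mem {W : Submodule ℂ U} (hW : D.Stable (M * N) W) (hMN : M.Coprime N)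
    {a b : ZMod M → ℂ} (ha : ∑ x, a x • D.F x ∈ W)
    (hb : ∀ x y, y - x ∈ D.periods → b y = b x) : ∑ x, (a x * b x) • D.F x ∈ W := by
  classical
  refine mem_of_sum_coset_mem D.periods fun x₀ => ?_
  have := W.smul_mem (b x₀) (sum_coset_mem hW hMN ha x₀)
  rw [Finset.smul_sum] at this
  convert this using 2 with x
  rw [smul_smul]
  congr 1
  split_ifs with h
  · rw [hb _ _ h, mul_comm]
  · simp

end SignedAction

/-! ### Powers of integral matrices of trace two -/

open Polynomial in
theorem one_add_natCast_mul_pow {R : Type*} [Ring R] (q n : ℕ) (y : R) :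
    ∃ z : R, (1 + (q : R) * y) ^ n = 1 + ((n * q : ℕ) : R) * y + ((q * q : ℕ) : R) * z := by
  have key : ∃ z : ℤ[X], (1 + (q : ℤ[X]) * X) ^ n =
      1 + ((n * q : ℕ) : ℤ[X]) * X + ((q * q : ℕ) : ℤ[X]) * z := by
    induction n with
    | zero => exact ⟨0, by simp⟩
    | succ n ih =>
      obtain ⟨z, hz⟩ := ih
      refine ⟨(n : ℤ[X]) * X ^ 2 + z + z * (q : ℤ[X]) * X, ?_⟩
      rw [pow_succ, hz]
      push_cast
      ring
  obtain ⟨z, hz⟩ := key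
  exact ⟨aeval y z, by simpa using congrArg (aeval y) hz⟩

theorem mem_Gamma_iff_exists {n : ℕ} {s : SL(2, ℤ)} :
    s ∈ Gamma n ↔ ∃ Y : Matrix (Fin 2) (Fin 2) ℤ, (s : Matrix (Fin 2) (Fin 2) ℤ) = 1 + n * Y := by
  have key : ∀ a b : ℤ, (a : ZMod n) = b ↔ ∃ y, a = b + n * y := fun a b => by
    rw [eq_comm, ZMod.intCast_eq_intCast_iff_dvd_sub]
    exact exists_congr fun y => sub_eq_iff_eq_add'
  have hn : ∀ (Y : Matrix (Fin 2) (Fin 2) ℤ) i j,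
      ((n : Matrix (Fin 2) (Fin 2) ℤ) * Y) i j = n * Y i j := fun Y i j => by
    rw [← nsmul_eq_mul, Matrix.smul_apply, nsmul_eq_mul]
  rw [Gamma_mem]
  have k00 := key (s 0 0) 1
  have k01 := key (s 0 1) 0
  have k10 := key (s 1 0) 0
  have k11 := key (s 1 1) 1
  push_cast at k00 k01 k10 k11
  rw [k00, k01, k10, k11]
  constructor
  · rintro ⟨⟨a, ha⟩, ⟨b, hb⟩, ⟨c, hc⟩, ⟨d, hd⟩⟩
    refine ⟨!![a, b; c, d], ?_⟩
    ext i j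
    rw [Matrix.add_apply, hn]
    fin_cases i <;> fin_cases j <;> simp [ha, hb, hc, hd]
  · rintro ⟨Y, hY⟩
    have h : ∀ i j, s i j = (1 : Matrix (Fin 2) (Fin 2) ℤ) i j + n * Y i j := fun i j => by
      rw [← hn, ← Matrix.add_apply, ← hY]
    exact ⟨⟨Y 0 0, by simp [h]⟩, ⟨Y 0 1, by simp [h]⟩, ⟨Y 1 0, by simp [h]⟩, ⟨Y 1 1, by simp [h]⟩⟩

theorem Gamma_inf {a b : ℕ} (hab : a.Coprime b) {s : SL(2, ℤ)} (ha : s ∈ Gamma a)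
    (hb : s ∈ Gamma b) : s ∈ Gamma (a * b) := by
  have key : ∀ x y : ℤ, (x : ZMod a) = y → (x : ZMod b) = y → (x : ZMod (a * b)) = y := by
    intro x y h1 h2
    rw [ZMod.intCast_eq_intCast_iff_dvd_sub] at *
    push_cast
    exact (Nat.isCoprime_iff_coprime.2 hab).mul_dvd h1 h2
  rw [Gamma_mem] at *
  refine ⟨?_, ?_, ?_, ?_⟩
  · simpa using key _ 1 (by simpa using ha.1) (by simpa using hb.1)
  · simpa using key _ 0 (by simpa using ha.2.1) (by simpa using hb.2.1)
  · simpa using key _ 0 (by simpa using ha.2.2.1) (by simpa using hb.2.2.1)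
  · simpa using key _ 1 (by simpa using ha.2.2.2) (by simpa using hb.2.2.2)

/-- A matrix of trace two is unipotent, so its `n`-th power is trivial modulo `n`. -/
theorem pow_mem_Gamma_of_trace {n : ℕ} {s : SL(2, ℤ)} (h : (n : ℤ) ∣ s 0 0 + s 1 1 - 2) :
    s ^ n ∈ Gamma n := by
  obtain ⟨t, ht⟩ := h
  have hdet := SL2_det s
  -- Cayley-Hamilton: `(s - 1)² = (tr s - 2) s`
  have hsq : ((s : Matrix (Fin 2) (Fin 2) ℤ) - 1) * ((s : Matrix (Fin 2) (Fin 2) ℤ) - 1) =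
      (n * t) • (s : Matrix (Fin 2) (Fin 2) ℤ) := by
    rw [← ht]
    ext i j
    rw [Matrix.mul_apply, Fin.sum_univ_two]
    fin_cases i <;> fin_cases j <;> simp <;> linarith
  have key : ∀ m : ℕ, ∃ Y : Matrix (Fin 2) (Fin 2) ℤ,
      (s : Matrix (Fin 2) (Fin 2) ℤ) ^ m = 1 + m * ((s : Matrix (Fin 2) (Fin 2) ℤ) - 1) + n * Y := by
    intro m
    induction m with
    | zero => exact ⟨0, by simp⟩
    | succ m ih =>
      obtain ⟨Y, hY⟩ := ih
      set S := (s : Matrix (Fin 2) (Fin 2) ℤ)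
      refine ⟨m * (t • S) + Y * S, ?_⟩
      have e : (m : Matrix (Fin 2) (Fin 2) ℤ) * (S - 1) * S =
          m * (S - 1) + n * (m * (t • S)) := by
        have : (S - 1) * S = (S - 1) + (S - 1) * (S - 1) := by noncomm_ring
        rw [mul_assoc, this, hsq, mul_add, mul_smul]
        congr 1
        rw [← nsmul_eq_mul, ← nsmul_eq_mul, ← nsmul_eq_mul, natCast_zsmul, smul_comm]
      rw [pow_succ, hY, add_mul, add_mul, e]
      push_cast
      noncomm_ring
  obtain ⟨Y, hY⟩ := key n
  rw [mem_Gamma_iff_exists]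
  refine ⟨(s - 1) + Y, ?_⟩
  rw [Matrix.SpecialLinearGroup.coe_pow, hY, mul_add, add_assoc]

theorem pow_pow_mem_Gamma {p : ℕ} {s : SL(2, ℤ)} (h : s ∈ Gamma p) (j : ℕ) :
    s ^ p ^ j ∈ Gamma (p ^ (j + 1)) := by
  induction j with
  | zero => simpa using h
  | succ j ih =>
    rw [mem_Gamma_iff_exists] at ih ⊢
    obtain ⟨Y, hY⟩ := ih
    obtain ⟨Z, hZ⟩ := one_add_natCast_mul_pow (p ^ (j + 1)) p Y
    refine ⟨Y + ((p ^ j : ℕ) : Matrix (Fin 2) (Fin 2) ℤ) * Z, ?_⟩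
    rw [pow_succ, pow_mul, Matrix.SpecialLinearGroup.coe_pow, hY, hZ, mul_add, add_assoc,
      ← mul_assoc, ← Nat.cast_mul]
    congr 4 <;> ring

theorem pow_mem_Gamma {p k Ms N : ℕ} (hk : 0 < k) (hp : p.Coprime Ms)
    (hN : (p ^ k * Ms).Coprime N) {s : SL(2, ℤ)} (hs : s ∈ Gamma N)
    (h1 : (p : ℤ) ∣ s 0 0 + s 1 1 - 2) (h2 : (Ms : ℤ) ∣ s 0 0 + s 1 1 - 2) :
    s ^ (p ^ k * Ms) ∈ Gamma (p ^ k * Ms * N) := by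
  refine Gamma_inf hN (Gamma_inf (hp.pow_left k) ?_ ?_) (pow_mem hs _)
  · obtain ⟨j, rfl⟩ := Nat.exists_eq_succ_of_ne_zero hk.ne'
    rw [pow_mul]
    refine pow_mem ?_ _
    rw [Nat.succ_eq_add_one, pow_succ', pow_mul, ← pow_succ']
    exact pow_pow_mem_Gamma (pow_mem_Gamma_of_trace h1) j
  · rw [mul_comm, pow_mul]
    exact pow_mem (pow_mem_Gamma_of_trace h2) _

namespace SignedAction

variable {M N : ℕ} {G U : Type*} [Group G] [AddCommGroup U] [Module ℂ U]
  {D : SignedAction M N G U}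

/-! ### Signs on orbits of odd length -/

theorem adm_pow_of_mapsTo {X : Finset (ZMod M)} {g : G}
    (h : ∀ x ∈ X, D.Adm g x ∧ D.mv g x ∈ X) (n : ℕ) :
    ∀ x ∈ X, D.Adm (g ^ n) x ∧ D.mv (g ^ n) x ∈ X := by
  induction n with
  | zero =>
    intro x hx
    have h1 : D.mat (g ^ 0) ∈ Gamma (M * N) := by simp [one_mem]
    exact ⟨adm_of_mem h1 x, by rwa [mv_of_mem h1]⟩
  | succ n ih =>
    intro x hx
    have h1 := ih x hx
    have h2 := h _ h1.2
    rw [pow_succ]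
    exact ⟨h1.1.mul h2.1, by rw [mv_mul h1.1 h2.1]; exact h2.2⟩

/-- On a finite set of points preserved by two elements, the product of all signs is
multiplicative. -/
theorem prod_sgn_mul {X : Finset (ZMod M)} {g k : G} (h : ∀ x ∈ X, D.Adm g x ∧ D.mv g x ∈ X)
    (h' : ∀ x ∈ X, D.Adm k x) :
    ∏ x ∈ X, D.sgn (g * k) x = (∏ x ∈ X, D.sgn g x) * ∏ x ∈ X, D.sgn k x := by
  have hinj : Set.InjOn (D.mv g) X := fun x hx y hy hxy =>
    move_injective (h x hx).1.2 (h y hy).1.2 hxy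
  have himg : X.image (D.mv g) = X := by
    refine Finset.eq_of_subset_of_card_le ?_ (Finset.card_image_of_injOn hinj).ge
    intro y hy
    obtain ⟨x, hx, rfl⟩ := Finset.mem_image.1 hy
    exact (h x hx).2
  have : ∏ x ∈ X, D.sgn k x = ∏ x ∈ X, D.sgn k (D.mv g x) := by
    conv_lhs => rw [← himg]
    exact Finset.prod_image hinj
  rw [this, ← Finset.prod_mul_distrib]
  exact Finset.prod_congr rfl fun x hx => sgn_mul (h x hx).1 (h' _ (h x hx).2)

theorem prod_sgn_pow {X : Finset (ZMod M)} {g : G} (h : ∀ x ∈ X, D.Adm g x ∧ D.mv g x ∈ X)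
    (n : ℕ) : ∏ x ∈ X, D.sgn (g ^ n) x = (∏ x ∈ X, D.sgn g x) ^ n := by
  induction n with
  | zero =>
    rw [pow_zero, pow_zero]
    exact Finset.prod_eq_one fun x _ => by simpa using sgn_tr_pow (D := D) 0 x
  | succ n ih =>
    rw [pow_succ, pow_succ, ← ih]
    exact prod_sgn_mul (adm_pow_of_mapsTo h n) fun x hx => (h x hx).1

theorem sgn_pow_of_mv_eq {g : G} {x : ZMod M} (h : D.Adm g x) (hx : D.mv g x = x) (n : ℕ) :
    D.sgn (g ^ n) x = D.sgn g x ^ n := by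
  have := prod_sgn_pow (X := {x}) (g := g) (D := D)
    (fun y hy => by rw [Finset.mem_singleton.1 hy]; exact ⟨h, by simp [hx]⟩) n
  simpa using this

theorem units_pow_odd (u : ℤˣ) {n : ℕ} (hn : Odd n) : u ^ n = u := by
  rw [Int.units_pow_eq_pow_mod_two, Nat.odd_iff.1 hn, pow_one]

variable [NeZero M]

open Classical in
theorem odd_card_coset (hM : Odd M) (Q : AddSubgroup (ZMod M)) (x₀ : ZMod M) :
    Odd (Finset.univ.filter fun x => x - x₀ ∈ Q).card := by
  have h1 : (Finset.univ.filter fun x => x - x₀ ∈ Q).card = Nat.card Q := by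
    rw [Nat.card_eq_fintype_card, Fintype.card_subtype]
    refine Finset.card_bij' (fun y _ => y - x₀) (fun y _ => y + x₀) ?_ ?_ ?_ ?_ <;> simp
  have h2 : Nat.card Q ∣ M := by
    simpa using AddSubgroup.card_addSubgroup_dvd_card Q
  rw [h1]
  exact hM.of_dvd_nat h2

/-- Suppose that `g` preserves a coset of a group of periods, that it is unipotent modulo `Ms`, and
that its products with the translations by that group are unipotent modulo `p`.  Then, up to
elements over `Γ(MN)`, all of these have odd order, which forces `g` to act on the coset with a
constant sign, that of its power `g ^ M`. -/
theorem sgn_eq_sgn_pow {p k Ms : ℕ} (hM : M = p ^ k * Ms) (hk : 0 < k) (hp : p.Coprime Ms)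
    (hMN : M.Coprime N) (hodd : Odd M) {Q : AddSubgroup (ZMod M)} (hQ : Q ≤ D.periods)
    {x₀ : ZMod M} {g : G} (hgN : D.mat g ∈ Gamma N)
    (hA : (Ms : ℤ) ∣ D.mat g 0 0 - 1) (hC : (Ms : ℤ) ∣ D.mat g 1 0)
    (hD : (Ms : ℤ) ∣ D.mat g 1 1 - 1)
    (htr : ∀ m : ℕ, (m : ZMod M) * N ∈ Q →
      (p : ℤ) ∣ D.mat g 0 0 + D.mat g 1 1 - 2 + m * N * D.mat g 1 0)
    (hX : ∀ x, x - x₀ ∈ Q → IsUnit (rowDen M (D.mat g) x) ∧ D.mv g x - x₀ ∈ Q)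
    {x : ZMod M} (hx : x - x₀ ∈ Q) : D.sgn g x = D.sgn (g ^ M) x := by
  classical
  let X : Finset (ZMod M) := Finset.univ.filter fun x => x - x₀ ∈ Q
  have memX : ∀ {y}, y ∈ X ↔ y - x₀ ∈ Q := by simp [X]
  have hg : ∀ y ∈ X, D.Adm g y ∧ D.mv g y ∈ X := fun y hy =>
    ⟨⟨hgN, (hX y (memX.1 hy)).1⟩, memX.2 (hX y (memX.1 hy)).2⟩
  have hpow : ∀ m : ℕ, (m : ZMod M) * N ∈ Q → D.mat ((g * D.tr ^ m) ^ M) ∈ Gamma (M * N) := by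
    intro m hm
    have e00 : D.mat (g * D.tr ^ m) 0 0 = D.mat g 0 0 := by
      rw [map_mul, mat_tr_pow, SL2_mul_apply]; simp
    have e11 : D.mat (g * D.tr ^ m) 1 1 = D.mat g 1 1 + m * N * D.mat g 1 0 := by
      rw [map_mul, mat_tr_pow, SL2_mul_apply]; simp; ring
    rw [map_pow]
    subst hM
    refine pow_mem_Gamma hk hp hMN ?_ ?_ ?_
    · rw [map_mul, mat_tr_pow]
      exact mul_mem hgN (transl_mem_Gamma (Dvd.intro_left _ rfl))
    · rw [e00, e11]
      convert htr m hm using 1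
      ring1
    · rw [e00, e11]
      have := dvd_add (dvd_add hA hD) (hC.mul_left ((m : ℤ) * N))
      refine this.trans (dvd_of_eq ?_)
      ring
  -- elements over `Γ(MN)` have a constant sign on `X`, hence so does the product over `X`
  have hconst : ∀ κ, D.mat κ ∈ Gamma (M * N) → ∀ y ∈ X, ∏ z ∈ X, D.sgn κ z = D.sgn κ y := by
    intro κ hκ y hy
    have : ∀ z ∈ X, D.sgn κ z = D.sgn κ y := fun z hz => by
      have hmem : z - y ∈ D.periods := hQ (by
        have := Q.sub_mem (memX.1 hz) (memX.1 hy)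
        rwa [sub_sub_sub_cancel_right] at this)
      simpa using sgn_add_of_mem_periods hmem hκ y
    rw [Finset.prod_congr rfl this, Finset.prod_const, units_pow_odd _ (odd_card_coset hodd Q x₀)]
  have hxX := memX.2 hx
  -- a translation bringing the image of `x` back to `x`
  obtain ⟨m, hm⟩ := exists_mul_eq hMN (x - D.mv g x)
  have hmQ : (m : ZMod M) * N ∈ Q := by
    rw [hm, ← sub_sub_sub_cancel_right x _ x₀]
    exact Q.sub_mem hx (hX x hx).2
  have htrX : ∀ y ∈ X, D.Adm (D.tr ^ m) y ∧ D.mv (D.tr ^ m) y ∈ X := fun y hy =>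
    ⟨adm_tr_pow m y, memX.2 (by
      rw [mv_tr_pow, add_sub_right_comm]; exact Q.add_mem (memX.1 hy) hmQ)⟩
  have hgt : ∀ y ∈ X, D.Adm (g * D.tr ^ m) y ∧ D.mv (g * D.tr ^ m) y ∈ X := fun y hy =>
    ⟨(hg y hy).1.mul (adm_tr_pow m _), by
      rw [mv_mul (hg y hy).1 (adm_tr_pow m _)]; exact (htrX _ (hg y hy).2).2⟩
  have hfix : D.mv (g * D.tr ^ m) x = x := by
    rw [mv_mul (hg x hxX).1 (adm_tr_pow m _), mv_tr_pow, hm]; ring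
  calc D.sgn g x = D.sgn (g * D.tr ^ m) x := by
        rw [sgn_mul (hg x hxX).1 (adm_tr_pow m _), sgn_tr_pow, mul_one]
    _ = D.sgn ((g * D.tr ^ m) ^ M) x := by
        rw [sgn_pow_of_mv_eq (hgt x hxX).1 hfix, units_pow_odd _ hodd]
    _ = ∏ z ∈ X, D.sgn (g * D.tr ^ m) z := by
        rw [← hconst _ (hpow m hmQ) x hxX, prod_sgn_pow hgt, units_pow_odd _ hodd]
    _ = ∏ z ∈ X, D.sgn (g ^ M) z := by
        rw [prod_sgn_mul hg fun y _ => adm_tr_pow m y, prod_sgn_pow hg, units_pow_odd _ hodd]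
        simp [sgn_tr_pow]
    _ = D.sgn (g ^ M) x := by
        refine hconst _ ?_ x hxX
        simpa using hpow 0 (by simp [Q.zero_mem])

end SignedAction

/-! ### Residues modulo coprime factors -/

theorem isUnit_of_castHom {p k Ms M : ℕ} (hp : p.Prime) (hM : M = p ^ k * Ms) (hpM : p ∣ M)
    (hMsM : Ms ∣ M) {z : ZMod M} (h1 : ZMod.castHom hpM (ZMod p) z ≠ 0)
    (h2 : ZMod.castHom hMsM (ZMod Ms) z = 1) : IsUnit z := by
  obtain ⟨a, rfl⟩ := ZMod.intCast_surjective z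
  rw [map_intCast] at h1 h2
  rw [ZMod.coe_int_isUnit_iff_isCoprime, hM]
  push_cast
  refine IsCoprime.mul_left (IsCoprime.pow_left ?_) ?_
  · refine (Int.prime_iff_natAbs_prime.2 (by simpa using hp)).coprime_iff_not_dvd.2 ?_
    rwa [← ZMod.intCast_zmod_eq_zero_iff_dvd]
  · have := (ZMod.intCast_eq_intCast_iff_dvd_sub 1 a Ms).1 (by simpa using h2.symm)
    obtain ⟨t, ht⟩ := this
    exact ⟨-t, 1, by linarith⟩

theorem exists_eq_mul_of_castHom_eq_zero {n M : ℕ} (h : n ∣ M) {z : ZMod M}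
    (hz : ZMod.castHom h (ZMod n) z = 0) : ∃ y, z = n * y := by
  obtain ⟨a, rfl⟩ := ZMod.intCast_surjective z
  rw [map_intCast, ZMod.intCast_zmod_eq_zero_iff_dvd] at hz
  obtain ⟨t, rfl⟩ := hz
  exact ⟨t, by push_cast; rfl⟩

theorem castHom_rowDen {n M : ℕ} (h : n ∣ M) (s : SL(2, ℤ)) (x : ZMod M) :
    ZMod.castHom h (ZMod n) (rowDen M s x) = rowDen n s (ZMod.castHom h (ZMod n) x) := by
  simp only [rowDen, map_add, map_mul, map_intCast]

theorem castHom_rowNum {n M : ℕ} (h : n ∣ M) (s : SL(2, ℤ)) (x : ZMod M) :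
    ZMod.castHom h (ZMod n) (rowNum M s x) = rowNum n s (ZMod.castHom h (ZMod n) x) := by
  simp only [rowNum, map_add, map_mul, map_intCast]

/-- The congruence subgroup of level `n` does not move points modulo `n`. -/
theorem castHom_move {n M : ℕ} (h : n ∣ M) {s : SL(2, ℤ)} (hs : s ∈ Gamma n) {x : ZMod M}
    (hx : IsUnit (rowDen M s x)) :
    ZMod.castHom h (ZMod n) (move M s x) = ZMod.castHom h (ZMod n) x := by
  have := congrArg (ZMod.castHom h (ZMod n)) (rowDen_mul_move hx)
  rw [map_mul, castHom_rowDen, castHom_rowNum, rowDen_of_mem_Gamma hs, one_mul] at this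
  rw [this]
  rw [Gamma_mem] at hs
  simp [rowNum, hs.2.1, hs.2.2.2]

theorem AddSubgroup.zmod_mul_mem {M : ℕ} [NeZero M] (R : AddSubgroup (ZMod M)) (a : ZMod M)
    {n : ZMod M} (hn : n ∈ R) : a * n ∈ R := by
  have := R.nsmul_mem hn a.val
  rwa [nsmul_eq_mul, ZMod.natCast_zmod_val] at this

/-- A subgroup of `ℤ/p^k Ms` that contains an element prime to `p` contains all multiples of
`Ms`. -/
theorem mul_mem_of_castHom_ne_zero {p k Ms M : ℕ} [NeZero M] (hp : p.Prime)
    (hM : M = p ^ k * Ms) (hpM : p ∣ M) (R : AddSubgroup (ZMod M)) {n : ZMod M} (hn : n ∈ R)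
    (h : ZMod.castHom hpM (ZMod p) n ≠ 0) (y : ZMod M) : (Ms : ZMod M) * y ∈ R := by
  obtain ⟨a, rfl⟩ := ZMod.intCast_surjective n
  rw [map_intCast, Ne, ZMod.intCast_zmod_eq_zero_iff_dvd] at h
  have hcop : IsCoprime ((p : ℤ) ^ k) a :=
    ((Int.prime_iff_natAbs_prime.2 (by simpa using hp)).coprime_iff_not_dvd.2 h).pow_left
  obtain ⟨u, w, huw⟩ := hcop
  have h1 := congrArg (Int.cast : ℤ → ZMod M) huw
  have h2 : (p : ZMod M) ^ k * Ms = 0 := by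
    have := ZMod.natCast_self M
    rw [hM] at this ⊢
    exact_mod_cast this
  push_cast at h1
  have : (Ms : ZMod M) * y = (Ms * y * w) * a := by
    linear_combination (-(Ms * y : ZMod M)) * h1 + (u * y : ZMod M) * h2
  rw [this]
  exact R.zmod_mul_mem _ hn

/-! ### Conjugates of translations -/

theorem inv_transl_mul_entries (s : SL(2, ℤ)) (n : ℤ) :
    (s⁻¹ * transl n * s) 0 0 = 1 + n * s 1 0 * s 1 1 ∧
    (s⁻¹ * transl n * s) 0 1 = n * s 1 1 ^ 2 ∧
    (s⁻¹ * transl n * s) 1 0 = -(n * s 1 0 ^ 2) ∧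
    (s⁻¹ * transl n * s) 1 1 = 1 - n * s 1 0 * s 1 1 := by
  have h := SL2_det s
  have e : ∀ i j, s⁻¹ i j = !![s 1 1, -s 0 1; -s 1 0, s 0 0] i j := fun i j => by
    rw [Matrix.SpecialLinearGroup.SL2_inv_expl]; rfl
  simp only [SL2_mul_apply, e]
  refine ⟨?_, ?_, ?_, ?_⟩ <;> simp <;> linarith

theorem mul_transl_inv_entries (s : SL(2, ℤ)) (n : ℤ) :
    (s * transl n * s⁻¹) 0 0 = 1 - n * s 0 0 * s 1 0 ∧
    (s * transl n * s⁻¹) 0 1 = n * s 0 0 ^ 2 ∧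
    (s * transl n * s⁻¹) 1 0 = -(n * s 1 0 ^ 2) ∧
    (s * transl n * s⁻¹) 1 1 = 1 + n * s 0 0 * s 1 0 := by
  have h := SL2_det s
  have e : ∀ i j, s⁻¹ i j = !![s 1 1, -s 0 1; -s 1 0, s 0 0] i j := fun i j => by
    rw [Matrix.SpecialLinearGroup.SL2_inv_expl]; rfl
  simp only [SL2_mul_apply, e]
  refine ⟨?_, ?_, ?_, ?_⟩ <;> simp <;> linarith

namespace SignedAction

variable {M N : ℕ} {G U : Type*} [Group G] [AddCommGroup U] [Module ℂ U]
  {D : SignedAction M N G U}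

variable (D) in
/-- Either `M` is odd, or no signs occur at all. -/
def OddOrTrivial : Prop := Odd M ∨ ∀ g x, D.Adm g x → D.sgn g x = 1

theorem mul_tr_pow_mem (m : ℕ) : D.mat (D.tr ^ (m * M)) ∈ Gamma (M * N) := by
  rw [mat_tr_pow]
  exact transl_mem_Gamma ⟨m, by push_cast; ring⟩

variable [NeZero M]

/-- The sign of an element over `Γ(Ms N)` does not change under a translation by a period whose
conjugate by the element is upper triangular modulo `p`. -/
theorem sgn_add_eq (hD : D.OddOrTrivial) {p k Ms : ℕ} (hp : p.Prime) (hM : M = p ^ k * Ms)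
    (hk : 0 < k) (hpMs : p.Coprime Ms) (hMN : M.Coprime N) {γ : G}
    (hγ : D.mat γ ∈ Gamma (Ms * N)) {x : ZMod M} {m : ℕ} (hm : (m : ZMod M) * N ∈ D.periods)
    (hpm : (p : ℤ) ∣ m * N * D.mat γ 1 0) (hx : D.Adm γ x) (hy : D.Adm γ (x + m * N)) :
    D.sgn γ (x + m * N) = D.sgn γ x := by
  rcases hD with hodd | htriv
  swap
  · rw [htriv _ _ hx, htriv _ _ hy]
  have hpM : p ∣ M := hM ▸ (dvd_pow_self p hk.ne').mul_right Ms
  have hMsM : Ms ∣ M := hM ▸ Dvd.intro_left _ rfl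
  set g := γ⁻¹ * D.tr ^ m * γ with hg
  have hmat : D.mat g = (D.mat γ)⁻¹ * transl (m * N) * D.mat γ := by
    rw [hg, map_mul, map_mul, map_inv, mat_tr_pow]
  obtain ⟨e00, e01, e10, e11⟩ := inv_transl_mul_entries (D.mat γ) (m * N)
  rw [← hmat] at e00 e01 e10 e11
  have hMsC : (Ms : ℤ) ∣ D.mat γ 1 0 := by
    rw [← ZMod.intCast_zmod_eq_zero_iff_dvd]
    exact (Gamma_mem.1 (Gamma_mono (Dvd.intro _ rfl) hγ)).2.2.1
  set C : ℤ := D.mat γ 1 0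
  set E : ℤ := D.mat γ 1 1
  have hpC : ((m : ZMod p) * N * (C : ZMod p)) = 0 := by
    have := (ZMod.intCast_zmod_eq_zero_iff_dvd _ _).2 hpm
    exact_mod_cast this
  have hMsC' : (C : ZMod Ms) = 0 := (ZMod.intCast_zmod_eq_zero_iff_dvd _ _).2 hMsC
  have hden : ∀ z, IsUnit (rowDen M (D.mat g) z) := fun z => by
    have := Fact.mk hp
    refine isUnit_of_castHom hp hM hpM hMsM ?_ ?_
    · rw [castHom_rowDen, rowDen, e00, e10]
      push_cast
      have : ∀ z : ZMod p, (1 + m * N * C * E + -(m * N * C ^ 2) * z : ZMod p) = 1 := fun z => by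
        linear_combination ((E : ZMod p) - C * z) * hpC
      rw [this]
      exact one_ne_zero
    · rw [castHom_rowDen, rowDen, e00, e10]
      push_cast
      rw [hMsC']
      ring
  have hmv : ∀ z, D.mv g z - z ∈ D.periods := fun z => by
    have h1 := rowDen_mul_move (hden z)
    obtain ⟨u, hu⟩ := hden z
    have h2 : D.mv g z - z = (↑u⁻¹ * (E - C * z) ^ 2) * (m * N) := by
      refine (hden z).mul_left_cancel ?_
      rw [mul_sub, mv, h1, ← hu, mul_assoc, ← mul_assoc (u : ZMod M), u.mul_inv, one_mul, hu]
      simp only [rowDen, rowNum, e00, e01, e10, e11]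
      push_cast
      ring
    rw [h2]
    exact D.periods.zmod_mul_mem _ hm
  have hgN : D.mat g ∈ Gamma N := conj_mem' (adm_tr_pow m x).1 γ
  have key : D.sgn g (D.mv γ x) = 1 := by
    rw [sgn_eq_sgn_pow hM hk hpMs hMN hodd le_rfl (x₀ := D.mv γ x) hgN ?_ ?_ ?_ ?_ ?_ (by simp)]
    · have hpow : g ^ M = γ⁻¹ * D.tr ^ (m * M) * γ := by
        rw [hg, pow_mul]
        simpa using conj_pow (i := M) (a := γ⁻¹) (b := D.tr ^ m)
      have hκ := conj_mem' (mul_tr_pow_mem (D := D) m) γ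
      rw [hpow, ← sgn_conj_eq hκ hx]
      simpa [mul_assoc] using sgn_tr_pow (D := D) (m * M) x
    · rw [e00]
      exact ⟨m * N * (C / Ms) * E, by
        obtain ⟨c, hc⟩ := hMsC
        rcases Nat.eq_zero_or_pos Ms with h0 | h0
        · simp [hc, h0]
        · rw [hc, Int.mul_ediv_cancel_left _ (by exact_mod_cast h0.ne')]; ring⟩
    · rw [e10]
      exact (dvd_neg).2 ((dvd_pow hMsC two_ne_zero).mul_left _)
    · rw [e11]
      have : (1 - m * N * C * E - 1 : ℤ) = C * (-(m * N * E)) := by ring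
      rw [this]
      exact hMsC.mul_right _
    · intro m' _
      rw [e00, e11, e10]
      have : (1 + m * N * C * E + (1 - m * N * C * E) - 2 + m' * N * -(m * N * C ^ 2) : ℤ) =
          m * N * C * (-(m' * N * C)) := by ring
      rw [this]
      exact hpm.mul_right _
    · intro z hz
      exact ⟨hden z, by simpa using D.periods.add_mem (hmv z) hz⟩
  have hcomm : D.tr ^ m * γ = γ * g := by rw [hg]; group
  have h1 := sgn_mul (adm_tr_pow (D := D) m x) (k := γ) (by rwa [mv_tr_pow])
  rw [hcomm, sgn_mul hx ⟨hgN, hden _⟩, key, mv_tr_pow, sgn_tr_pow, mul_one, one_mul] at h1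
  exact h1.symm

/-- An element `γ` over `Γ(Ms N)` that moves the residue class `0` modulo `p` to infinity conjugates
a translation to an element that permutes the vectors of this class without signs. -/
theorem act_conj_tr (hD : D.OddOrTrivial) {p k Ms : ℕ} (hp : p.Prime) (hM : M = p ^ k * Ms)
    (hk : 0 < k) (hpMs : p.Coprime Ms) (hMN : M.Coprime N) (hpM : p ∣ M) (hMsM : Ms ∣ M)
    (hR : ∀ y : ZMod M, (Ms : ZMod M) * y ∈ D.periods) {γ : G}
    (hγ : D.mat γ ∈ Gamma (Ms * N)) (hA : (p : ℤ) ∣ D.mat γ 0 0) {x : ZMod M}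
    (hx : ZMod.castHom hpM (ZMod p) x = 0) :
    ∃ y, D.act (γ * D.tr ^ Ms * γ⁻¹) (D.F x) = D.F y ∧ ZMod.castHom hpM (ZMod p) y = 0 ∧
      (∃ z, y = x + Ms * z) ∧ y = D.mv (γ * D.tr ^ Ms * γ⁻¹) x ∧
      IsUnit (rowDen M (D.mat (γ * D.tr ^ Ms * γ⁻¹)) x) := by
  have := Fact.mk hp
  set g := γ * D.tr ^ Ms * γ⁻¹ with hg
  have hmat : D.mat g = D.mat γ * transl (Ms * N) * (D.mat γ)⁻¹ := by
    rw [hg, map_mul, map_mul, map_inv, mat_tr_pow]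
  obtain ⟨e00, e01, e10, e11⟩ := mul_transl_inv_entries (D.mat γ) (Ms * N)
  rw [← hmat] at e00 e01 e10 e11
  have hγMs := Gamma_mem.1 (Gamma_mono (Dvd.intro _ rfl) hγ : D.mat γ ∈ Gamma Ms)
  have hdet := SL2_det_cast (D.mat γ) (ZMod p)
  set A : ℤ := D.mat γ 0 0
  set C : ℤ := D.mat γ 1 0
  have hA' : (A : ZMod p) = 0 := (ZMod.intCast_zmod_eq_zero_iff_dvd _ _).2 hA
  have hC' : (C : ZMod p) ≠ 0 := fun h => by simp [hA', h] at hdet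
  have hden : ∀ z, ZMod.castHom hpM (ZMod p) z = 0 → IsUnit (rowDen M (D.mat g) z) := fun z hz => by
    refine isUnit_of_castHom hp hM hpM hMsM ?_ ?_
    · rw [castHom_rowDen, rowDen, e00, e10, hz]
      push_cast
      rw [hA']
      simp
    · rw [castHom_rowDen, rowDen, e00, e10]
      simp
  have hmv : ∀ z, ZMod.castHom hpM (ZMod p) z = 0 →
      ∃ w, D.mv g z = z + Ms * w ∧ ZMod.castHom hpM (ZMod p) w = 0 := fun z hz => by
    have h1 := rowDen_mul_move (hden z hz)
    obtain ⟨u, hu⟩ := hden z hz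
    refine ⟨↑u⁻¹ * N * (A + C * z) ^ 2, ?_, ?_⟩
    · rw [← sub_eq_iff_eq_add']
      refine (hden z hz).mul_left_cancel ?_
      have : ∀ a b c : ZMod M, u * (a * (↑u⁻¹ * b * c)) = a * b * c := fun a b c => by
        linear_combination (a * b * c) * u.mul_inv
      rw [mul_sub, mv, h1, ← hu, this, hu]
      simp only [rowDen, rowNum, e00, e01, e10, e11]
      push_cast
      ring
    · simp only [map_mul, map_pow, map_add, map_intCast, hA', hz]
      simp
  have hgN : D.mat g ∈ Gamma N := conj_mem (adm_tr_pow Ms x).1 γ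
  have hsgn : D.sgn g x = 1 := by
    rcases hD with hodd | htriv
    swap
    · exact htriv _ _ ⟨hgN, hden x hx⟩
    let Q : AddSubgroup (ZMod M) := D.periods ⊓ (ZMod.castHom hpM (ZMod p)).toAddMonoidHom.ker
    have memQ : ∀ {z}, z ∈ Q ↔ z ∈ D.periods ∧ ZMod.castHom hpM (ZMod p) z = 0 := Iff.rfl
    rw [sgn_eq_sgn_pow hM hk hpMs hMN hodd (inf_le_left : Q ≤ _) (x₀ := x) hgN ?_ ?_ ?_ ?_ ?_
      (by simp)]
    · have hpow : g ^ M = γ * D.tr ^ (Ms * M) * γ⁻¹ := by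
        rw [hg, pow_mul]
        exact conj_pow
      have hκ := conj_mem (mul_tr_pow_mem (D := D) Ms) γ
      -- compare with the point `x + Ms`, which `γ` keeps in the affine line
      have hadm : D.Adm γ (x + Ms * 1) := by
        refine ⟨Gamma_mono (Dvd.intro_left _ rfl) hγ, isUnit_of_castHom hp hM hpM hMsM ?_ ?_⟩
        · rw [castHom_rowDen, rowDen, hA', map_add, hx, mul_one, map_natCast, zero_add, zero_add]
          refine mul_ne_zero hC' fun h => ?_
          rw [ZMod.natCast_eq_zero_iff] at h
          exact hp.one_lt.ne' (Nat.dvd_one.1 (hpMs ▸ Nat.dvd_gcd dvd_rfl h))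
        · rw [castHom_rowDen, rowDen, hγMs.1, hγMs.2.2.1]
          simp
      rw [hpow, ← sgn_add_of_mem_periods (hR 1) hκ x,
        sgn_conj_eq (mul_tr_pow_mem (D := D) Ms) hadm, sgn_tr_pow]
    · rw [e00]
      exact ⟨-(N * A * C), by ring⟩
    · rw [e10]
      exact ⟨-(N * C ^ 2), by ring⟩
    · rw [e11]
      exact ⟨N * A * C, by ring⟩
    · intro m hm
      have h0 : (p : ℤ) ∣ m * N := by
        have := (memQ.1 hm).2
        rw [map_mul, map_natCast, map_natCast] at this
        rw [← ZMod.intCast_zmod_eq_zero_iff_dvd]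
        exact_mod_cast this
      rw [e00, e11, e10]
      have : (1 - Ms * N * A * C + (1 + Ms * N * A * C) - 2 + m * N * -(Ms * N * C ^ 2) : ℤ) =
          m * N * (-(Ms * N * C ^ 2)) := by ring
      rw [this]
      exact h0.mul_right _
    · intro z hz
      have hz0 : ZMod.castHom hpM (ZMod p) z = 0 := by
        have := (memQ.1 hz).2
        rwa [map_sub, hx, sub_zero] at this
      obtain ⟨w, hw, hw0⟩ := hmv z hz0
      refine ⟨hden z hz0, ?_⟩
      rw [hw, add_sub_right_comm]
      exact Q.add_mem hz (memQ.2 ⟨hR w, by rw [map_mul, hw0, mul_zero]⟩)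
  obtain ⟨w, hw, hw0⟩ := hmv x hx
  refine ⟨D.mv g x, ?_, ?_, ⟨w, hw⟩, rfl, hden x hx⟩
  · rw [Adm.act_F ⟨hgN, hden x hx⟩, hsgn]
    simp
  · rw [hw, map_add, hx, map_mul, hw0, mul_zero, add_zero]

end SignedAction

/-! ### Nonvanishing of a Fourier coefficient -/

theorem Int.exists_dvd_sub_of_isCoprime {a b : ℤ} (h : IsCoprime a b) (r s : ℤ) :
    ∃ x, a ∣ x - r ∧ b ∣ x - s := by
  obtain ⟨u, v, huv⟩ := h
  exact ⟨s * (u * a) + r * (v * b), ⟨u * (s - r), by linear_combination r * huv⟩,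
    ⟨v * (r - s), by linear_combination s * huv⟩⟩

/-- A nontrivial Fourier coefficient of a function on `ℤ/p` with values `±1` away from its only
zero does not vanish: the relations between the powers of a primitive `p`-th root of unity are the
multiples of one with equal coefficients. -/
theorem sum_addChar_mul_sign_ne_zero {p : ℕ} [Fact p.Prime] (c : ZMod p → ℤ) (h0 : c 0 = 0)
    (h1 : c 1 ≠ 0) : ∑ v, ZMod.stdAddChar (-v) * (c v : ℂ) ≠ 0 := by
  have hp : p.Prime := Fact.out
  set ζ : ℂ := ZMod.stdAddChar (-1 : ZMod p) with hζ
  have hpow : ∀ v : ZMod p, ZMod.stdAddChar (-v) = ζ ^ v.val := fun v => by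
    rw [hζ, ← AddChar.map_nsmul_eq_pow, nsmul_eq_mul, ZMod.natCast_zmod_val, mul_neg_one]
  have hprim : IsPrimitiveRoot ζ p := by
    refine (IsPrimitiveRoot.iff_orderOf).2 (orderOf_eq_prime ?_ ?_)
    · rw [hζ, ← AddChar.map_nsmul_eq_pow]
      simp
    · intro h
      have := ZMod.injective_stdAddChar (h.trans (AddChar.map_zero_eq_one _).symm)
      simp at this
  obtain ⟨q, rfl⟩ := Nat.exists_eq_succ_of_ne_zero hp.ne_zero
  intro hsum
  have key : ∑ v : ZMod q.succ, (c v : ℂ) * ζ ^ v.val = 0 := by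
    rw [← hsum]
    exact Finset.sum_congr rfl fun v _ => by rw [hpow, mul_comm]
  exact h1 (((hprim.sum_eq_zero_iff_forall_eq_int hp c).1 key 1 0).trans h0)

namespace SignedAction

variable {M N : ℕ} {G U : Type*} [Group G] [AddCommGroup U] [Module ℂ U]
  {D : SignedAction M N G U}

/-! ### Antidiagonal elements modulo `p` -/

theorem adm_of_antidiagonal {p k Ms : ℕ} (hp : p.Prime) (hM : M = p ^ k * Ms) (hpM : p ∣ M)
    (hMsM : Ms ∣ M) {γ : G} (hγ : D.mat γ ∈ Gamma (Ms * N)) (hA : (p : ℤ) ∣ D.mat γ 0 0)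
    (hE : (p : ℤ) ∣ D.mat γ 1 1) {x : ZMod M} (hx : ZMod.castHom hpM (ZMod p) x ≠ 0) :
    D.Adm γ x ∧ ZMod.castHom hpM (ZMod p) (D.mv γ x) ≠ 0 ∧ ∃ y, D.mv γ x - x = Ms * y := by
  have := Fact.mk hp
  have hγMs : D.mat γ ∈ Gamma Ms := Gamma_mono (Dvd.intro _ rfl) hγ
  have hγMs' := Gamma_mem.1 hγMs
  have hdet := SL2_det_cast (D.mat γ) (ZMod p)
  have hA' := (ZMod.intCast_zmod_eq_zero_iff_dvd _ _).2 hA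
  have hE' := (ZMod.intCast_zmod_eq_zero_iff_dvd _ _).2 hE
  rw [hA', zero_mul, zero_sub] at hdet
  have hB : (D.mat γ 0 1 : ZMod p) ≠ 0 := fun h => by simp [h] at hdet
  have hC : (D.mat γ 1 0 : ZMod p) ≠ 0 := fun h => by simp [h] at hdet
  have hden : IsUnit (rowDen M (D.mat γ) x) := by
    refine isUnit_of_castHom hp hM hpM hMsM ?_ ?_
    · rw [castHom_rowDen, rowDen, hA', zero_add]
      exact mul_ne_zero hC hx
    · rw [castHom_rowDen, rowDen_of_mem_Gamma hγMs]
  refine ⟨⟨Gamma_mono (Dvd.intro_left _ rfl) hγ, hden⟩, fun h0 => ?_, ?_⟩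
  · have := congrArg (ZMod.castHom hpM (ZMod p)) (rowDen_mul_move hden)
    rw [map_mul, castHom_rowNum, rowNum, hE', zero_mul, add_zero] at this
    rw [mv] at h0
    rw [h0, mul_zero] at this
    exact hB this.symm
  · refine exists_eq_mul_of_castHom_eq_zero hMsM ?_
    rw [map_sub, mv, castHom_move hMsM hγMs hden, sub_self]

theorem mv_inv_mv {γ : G} {x : ZMod M} (h : D.Adm γ x) (h' : D.Adm γ⁻¹ (D.mv γ x)) :
    D.mv γ⁻¹ (D.mv γ x) = x := by
  rw [← mv_mul h h', mul_inv_cancel]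
  exact mv_of_mem (by simp [one_mem]) x

theorem exists_antidiagonal {p Ms : ℕ} (hp : p.Coprime (Ms * N)) (D : SignedAction M N G U) :
    ∃ γ, D.mat γ ∈ Gamma (Ms * N) ∧ (p : ℤ) ∣ D.mat γ 0 0 ∧ (p : ℤ) ∣ D.mat γ 1 1 := by
  obtain ⟨x, ⟨t, ht⟩, hx0⟩ :=
    Int.exists_dvd_sub_of_isCoprime (Nat.isCoprime_iff_coprime.2 hp) 1 0
  rw [sub_zero] at hx0
  -- the product `(1 -x; 0 1) (1 0; x 1) (1 -x; 0 1)`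
  obtain ⟨γ, hγ⟩ := D.mat_surjective
    ⟨!![1 - x ^ 2, -x * (1 - x ^ 2) - x; x, 1 - x ^ 2], by rw [Matrix.det_fin_two]; simp; ring⟩
  have e00 : D.mat γ 0 0 = 1 - x ^ 2 := by rw [hγ]; rfl
  have e01 : D.mat γ 0 1 = -x * (1 - x ^ 2) - x := by rw [hγ]; rfl
  have e10 : D.mat γ 1 0 = x := by rw [hγ]; rfl
  have e11 : D.mat γ 1 1 = 1 - x ^ 2 := by rw [hγ]; rfl
  have h0 : (x : ZMod (Ms * N)) = 0 := (ZMod.intCast_zmod_eq_zero_iff_dvd _ _).2 hx0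
  have hd : (p : ℤ) ∣ 1 - x ^ 2 := ⟨-t * (1 + x), by linear_combination (-(1 + x)) * ht⟩
  refine ⟨γ, ?_, by rwa [e00], by rwa [e11]⟩
  rw [Gamma_mem, e00, e01, e10, e11]
  push_cast
  simp [h0]

/-! ### Twisting by an element that moves points to infinity -/

variable [NeZero M]

/-- The case of a character trivial on the multiples of `Ms`.  An element over `Γ(Ms N)`,
antidiagonal modulo `p`, moves the residue class `0` modulo `p` to infinity and no point to this
class.  The former part is invariant under translations and projected away, and the rest has
nonvanishing Fourier coefficients. -/
theorem sum_coset_twist_mem (hD : D.OddOrTrivial) {p k Ms : ℕ} (hp : p.Prime)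
    (hM : M = p ^ k * Ms) (hk : 0 < k) (hpMs : p.Coprime Ms) (hMN : M.Coprime N) (hpM : p ∣ M)
    (hMsM : Ms ∣ M) (hR : ∀ y : ZMod M, (Ms : ZMod M) * y ∈ D.periods)
    {W : Submodule ℂ U} (hW : D.Stable (Ms * N) W) {ψ : AddChar (ZMod M) ℂ}
    (hψ : ∀ y, ψ (Ms * y) = 1) (x₀ : ZMod M) [Fact p.Prime] [DecidablePred (· ∈ D.periods)]
    (hS : ∑ x, (if x - x₀ ∈ D.periods then ψ x else 0) • D.F x ∈ W) :
    ∑ x, (if x - x₀ ∈ D.periods then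
      ψ x * ZMod.stdAddChar (ZMod.castHom hpM (ZMod p) x) else 0) • D.F x ∈ W := by
  classical
  set π := ZMod.castHom hpM (ZMod p) with hπ
  have hpN : p.Coprime (Ms * N) := hpMs.mul_right (hMN.coprime_dvd_left hpM)
  obtain ⟨γ, hγ, hA, hE⟩ := exists_antidiagonal hpN D
  have hγ' : D.mat γ⁻¹ ∈ Gamma (Ms * N) := by rw [map_inv]; exact inv_mem hγ
  have hinv : ∀ i j, D.mat γ⁻¹ i j = !![D.mat γ 1 1, -D.mat γ 0 1; -D.mat γ 1 0, D.mat γ 0 0] i j :=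
    fun i j => by rw [map_inv, Matrix.SpecialLinearGroup.SL2_inv_expl]; rfl
  have hA' : (p : ℤ) ∣ D.mat γ⁻¹ 0 0 := by rw [hinv]; simpa using hE
  have hE' : (p : ℤ) ∣ D.mat γ⁻¹ 1 1 := by rw [hinv]; simpa using hA
  have adm := fun x (hx : π x ≠ 0) => adm_of_antidiagonal hp hM hpM hMsM hγ hA hE hx
  have adm' := fun x (hx : π x ≠ 0) => adm_of_antidiagonal hp hM hpM hMsM hγ' hA' hE' hx
  have ψeq : ∀ {x y : ZMod M}, (∃ z, x - y = Ms * z) → ψ x = ψ y := by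
    rintro x y ⟨z, hz⟩
    rw [eq_add_of_sub_eq hz, AddChar.map_add_eq_mul, hψ, one_mul]
  have cls : ∀ {x y : ZMod M}, (∃ z, x - y = Ms * z) → y - x₀ ∈ D.periods →
      x - x₀ ∈ D.periods := by
    rintro x y ⟨z, hz⟩ hy
    rw [← sub_add_sub_cancel x y x₀, hz]
    exact D.periods.add_mem (hR z) hy
  -- the part moved to infinity by `γ`, and the rest
  let Y := Finset.univ.filter fun x : ZMod M => x - x₀ ∈ D.periods ∧ π x = 0
  let Z := Finset.univ.filter fun x : ZMod M => x - x₀ ∈ D.periods ∧ π x ≠ 0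
  have memY : ∀ {x}, x ∈ Y ↔ x - x₀ ∈ D.periods ∧ π x = 0 := by simp [Y]
  have memZ : ∀ {x}, x ∈ Z ↔ x - x₀ ∈ D.periods ∧ π x ≠ 0 := by simp [Z]
  set Φ := ∑ x ∈ Y, ψ x • D.F x with hΦ
  have hsplit : ∑ x, (if x - x₀ ∈ D.periods then ψ x else 0) • D.F x =
      Φ + ∑ x ∈ Z, ψ x • D.F x := by
    rw [hΦ, Finset.sum_filter, Finset.sum_filter, ← Finset.sum_add_distrib]
    refine Finset.sum_congr rfl fun x _ => ?_
    by_cases h1 : x - x₀ ∈ D.periods <;> by_cases h2 : π x = 0 <;> simp [h1, h2]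
  have hΦγ : D.act (D.tr ^ Ms) (D.act γ Φ) = D.act γ Φ := by
    set g := γ * D.tr ^ Ms * γ⁻¹ with hg
    have h1 := fun x (hx : π x = 0) => act_conj_tr hD hp hM hk hpMs hMN hpM hMsM hR hγ hA hx
    have h2 : D.act g Φ = Φ := by
      have hmaps : ∀ x ∈ Y, D.mv g x ∈ Y := fun x hx => by
        obtain ⟨y, -, hy0, ⟨z, hz⟩, rfl, -⟩ := h1 x (memY.1 hx).2
        exact memY.2 ⟨cls ⟨z, by rw [hz]; ring⟩ (memY.1 hx).1, hy0⟩
      have hinj : Set.InjOn (D.mv g) Y := fun x hx x' hx' h => by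
        obtain ⟨_, -, -, -, -, hu⟩ := h1 x (memY.1 hx).2
        obtain ⟨_, -, -, -, -, hu'⟩ := h1 x' (memY.1 hx').2
        exact move_injective hu hu' h
      have himg : Y.image (D.mv g) = Y := by
        refine Finset.eq_of_subset_of_card_le ?_ (Finset.card_image_of_injOn hinj).ge
        intro y hy
        obtain ⟨x, hx, rfl⟩ := Finset.mem_image.1 hy
        exact hmaps x hx
      conv_rhs => rw [hΦ, ← himg, Finset.sum_image hinj]
      rw [hΦ, map_sum]
      refine Finset.sum_congr rfl fun x hx => ?_
      obtain ⟨y, hy, -, ⟨z, hz⟩, hmv, -⟩ := h1 x (memY.1 hx).2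
      rw [map_smul, hy, ← hmv, (ψeq ⟨z, by rw [hz]; ring⟩ : ψ y = ψ x)]
    have h3 : γ * D.tr ^ Ms = g * γ := by rw [hg]; group
    rw [← act_mul, h3, act_mul, h2]
  have hΦn : ∀ n, D.act (D.tr ^ (Ms * n)) (D.act γ Φ) = D.act γ Φ := fun n => by
    induction n with
    | zero => simp [act_one]
    | succ n ih => rw [mul_add, mul_one, pow_add, act_mul, ih, hΦγ]
  -- the coefficients of the image of the rest
  let a : ZMod M → ℤ := fun y => if y - x₀ ∈ D.periods ∧ π y ≠ 0 then D.sgn γ (D.mv γ⁻¹ y) else 0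
  have ha : D.act γ (∑ x ∈ Z, ψ x • D.F x) = ∑ y, (ψ y * a y) • D.F y := by
    have : ∑ y, (ψ y * a y) • D.F y =
        ∑ y ∈ Z, (ψ y * ((D.sgn γ (D.mv γ⁻¹ y) : ℤ) : ℂ)) • D.F y := by
      rw [Finset.sum_filter]
      refine Finset.sum_congr rfl fun y _ => ?_
      simp only [a]
      split_ifs <;> simp
    rw [this, map_sum]
    refine Finset.sum_bij' (fun x _ => D.mv γ x) (fun y _ => D.mv γ⁻¹ y) ?_ ?_ ?_ ?_ ?_
    · intro x hx
      obtain ⟨-, h2, h3⟩ := adm x (memZ.1 hx).2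
      exact memZ.2 ⟨cls h3 (memZ.1 hx).1, h2⟩
    · intro x hx
      obtain ⟨-, h2, h3⟩ := adm' x (memZ.1 hx).2
      exact memZ.2 ⟨cls h3 (memZ.1 hx).1, h2⟩
    · intro x hx
      obtain ⟨h1, h2, -⟩ := adm x (memZ.1 hx).2
      exact mv_inv_mv h1 (adm' _ h2).1
    · intro y hy
      obtain ⟨h1, h2, -⟩ := adm' y (memZ.1 hy).2
      simpa using mv_inv_mv h1 (by simpa using (adm _ h2).1)
    · intro x hx
      obtain ⟨h1, h2, h3⟩ := adm x (memZ.1 hx).2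
      rw [map_smul, h1.act_F, smul_smul, mv_inv_mv h1 (adm' _ h2).1, ψeq h3]
  have hconst : ∀ y y', y - x₀ ∈ D.periods → y' - x₀ ∈ D.periods → π y = π y' → a y' = a y := by
    intro y y' hy hy' hyy
    by_cases h0 : π y = 0
    · simp [a, h0, ← hyy]
    have h0' : π y' ≠ 0 := hyy ▸ h0
    simp only [a, hy, hy', h0, h0', ne_eq, not_false_eq_true, and_self, if_true]
    obtain ⟨h1, h2, h3⟩ := adm' y h0
    obtain ⟨h1', h2', h3'⟩ := adm' y' h0'
    have hmem : D.mv γ⁻¹ y' - D.mv γ⁻¹ y ∈ D.periods := by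
      have := D.periods.sub_mem (cls h3' hy') (cls h3 hy)
      rwa [sub_sub_sub_cancel_right] at this
    have hπeq : π (D.mv γ⁻¹ y') = π (D.mv γ⁻¹ y) := by
      have e := congrArg π (rowDen_mul_move h1.2)
      have e' := congrArg π (rowDen_mul_move h1'.2)
      rw [map_mul, castHom_rowDen, castHom_rowNum] at e e'
      rw [← hπ, ← hyy, ← e] at e'
      refine mul_left_cancel₀ ?_ e'
      have := h1.2.map π
      rw [castHom_rowDen] at this
      exact this.ne_zero
    obtain ⟨m, hm⟩ := exists_mul_eq hMN (D.mv γ⁻¹ y' - D.mv γ⁻¹ y)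
    have hpm : (p : ℤ) ∣ m * N := by
      have h4 : π ((m : ZMod M) * N) = 0 := by rw [hm, map_sub, hπeq, sub_self]
      rw [map_mul, map_natCast, map_natCast] at h4
      rw [← ZMod.intCast_zmod_eq_zero_iff_dvd]
      exact_mod_cast h4
    have e : D.mv γ⁻¹ y' = D.mv γ⁻¹ y + m * N := by rw [hm]; ring
    rw [e, sgn_add_eq hD hp hM hk hpMs hMN hγ (hm ▸ hmem) (hpm.mul_right _) (adm _ h2).1]
    rw [← e]
    exact (adm _ h2').1
  -- a multiple of the translation in `Γ(Ms N)` for each residue class modulo `p`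
  have hunit : ((Ms * N : ℕ) : ZMod p) ≠ 0 := fun h => by
    rw [ZMod.natCast_eq_zero_iff] at h
    exact hp.one_lt.ne' (Nat.dvd_one.1 (hpN ▸ Nat.dvd_gcd dvd_rfl h))
  let step : ZMod p → ℕ := fun w => (w * ((Ms * N : ℕ) : ZMod p)⁻¹).val
  let c : ZMod p → ZMod M := fun w => Ms * (step w * N)
  have hπc : ∀ w, π (c w) = w := fun w => by
    simp only [c, step]
    rw [map_mul, map_mul, map_natCast, map_natCast, map_natCast, ZMod.natCast_zmod_val]
    push_cast at hunit ⊢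
    have h1 := (mul_ne_zero_iff.1 hunit).1
    have h2 := (mul_ne_zero_iff.1 hunit).2
    field_simp
  let b : ZMod p → ℤ := fun v => a (x₀ + c (v - π x₀))
  let B : ℂ := ∑ v, ZMod.stdAddChar (-v) * (b v : ℂ)
  have hbcls : ∀ v, x₀ + c (v - π x₀) - x₀ ∈ D.periods := fun v => by
    rw [add_sub_cancel_left]; exact hR _
  have hbπ : ∀ v, π (x₀ + c (v - π x₀)) = v := fun v => by rw [map_add, hπc]; ring
  have hB : B ≠ 0 := by
    refine sum_addChar_mul_sign_ne_zero b ?_ ?_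
    · simp only [b, a, hbπ]
      simp
    · simp only [b, a, hbπ, hbcls]
      simp
  have hcoef : ∀ y, ∑ w, ZMod.stdAddChar w * (a (y - c w) : ℂ) =
      if y - x₀ ∈ D.periods then ZMod.stdAddChar (π y) * B else 0 := by
    intro y
    split_ifs with hy
    · rw [Finset.mul_sum, ← Equiv.sum_comp (Equiv.subLeft (π y))]
      refine Finset.sum_congr rfl fun v _ => ?_
      have : a (y - c (π y - v)) = b v := by
        refine hconst _ _ (hbcls v) (cls ⟨-(step (π y - v) * N), ?_⟩ hy) ?_
        · simp only [c]; ring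
        · rw [hbπ, map_sub, hπc]; ring
      rw [Equiv.subLeft_apply, this, sub_eq_add_neg, AddChar.map_add_eq_mul, mul_assoc]
    · refine Finset.sum_eq_zero fun w _ => ?_
      have : a (y - c w) = 0 := by
        refine if_neg fun h => hy (cls ⟨step w * N, ?_⟩ h.1)
        simp only [c]; ring
      rw [this]
      simp
  have hE : ∑ w : ZMod p, (ZMod.stdAddChar w : ℂ) • D.act (D.tr ^ (Ms * step w)) (D.act γ
      (∑ x, (if x - x₀ ∈ D.periods then ψ x else 0) • D.F x)) ∈ W := by
    refine W.sum_mem fun w _ => W.smul_mem _ (hW _ ?_ _ (hW γ hγ _ hS))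
    rw [mat_tr_pow]
    exact transl_mem_Gamma ⟨step w, by push_cast; ring⟩
  have hsum0 : ∑ w : ZMod p, (ZMod.stdAddChar w : ℂ) = 0 := by
    refine AddChar.sum_eq_zero_of_ne_one fun h => ?_
    have : (1 : ZMod p) = 0 := ZMod.injective_stdAddChar (by rw [h]; simp)
    exact one_ne_zero this
  have hfinal : ∑ w : ZMod p, (ZMod.stdAddChar w : ℂ) • D.act (D.tr ^ (Ms * step w)) (D.act γ
      (∑ x, (if x - x₀ ∈ D.periods then ψ x else 0) • D.F x)) =
      B • ∑ x, (if x - x₀ ∈ D.periods then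
        ψ x * ZMod.stdAddChar (π x) else 0) • D.F x := by
    have h1 : ∀ w : ZMod p, (ZMod.stdAddChar w : ℂ) • D.act (D.tr ^ (Ms * step w)) (D.act γ
        (∑ x, (if x - x₀ ∈ D.periods then ψ x else 0) • D.F x)) =
        (ZMod.stdAddChar w : ℂ) • D.act γ Φ +
          ∑ y, (ψ y * (ZMod.stdAddChar w * (a (y - c w) : ℂ))) • D.F y := by
      intro w
      have e0 : ∑ y, (ψ y * a y) • D.F y = ∑ y, (ψ (y - c w) * a (y - c w)) • D.F (y - c w) :=
        (Equiv.sum_comp (Equiv.subRight (c w)) fun y => (ψ y * a y) • D.F y).symm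
      rw [hsplit, map_add, map_add, hΦn, ha, smul_add, e0]
      refine congrArg₂ (· + ·) rfl ?_
      rw [map_sum, Finset.smul_sum]
      refine Finset.sum_congr rfl fun y _ => ?_
      rw [map_smul, tr_pow_F, smul_smul]
      have e1 : y - c w + ((Ms * step w : ℕ) : ZMod M) * N = y := by
        simp only [c]; push_cast; ring
      have e2 : ψ (y - c w) = ψ y := ψeq ⟨-(step w * N), by simp only [c]; ring⟩
      rw [e1, e2]
      congr 1
      ring
    rw [Finset.sum_congr rfl fun w _ => h1 w, Finset.sum_add_distrib, ← Finset.sum_smul, hsum0,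
      zero_smul, zero_add, Finset.sum_comm, Finset.smul_sum]
    refine Finset.sum_congr rfl fun y _ => ?_
    rw [← Finset.sum_smul, ← Finset.mul_sum, hcoef, smul_smul]
    congr 1
    split_ifs <;> ring
  rw [hfinal] at hE
  have := W.smul_mem B⁻¹ hE
  rwa [smul_smul, inv_mul_cancel₀ hB, one_smul] at this

end SignedAction

namespace SignedAction

variable {M N : ℕ} {G U : Type*} [Group G] [AddCommGroup U] [Module ℂ U]
  {D : SignedAction M N G U}

/-! ### Twisting by a diagonal element -/

theorem exists_diagonal (D : SignedAction M N G U) {A : ℤ} (hA : IsCoprime A (M * N : ℤ)) :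
    ∃ γ, D.mat γ 0 0 = A ∧ (M * N : ℤ) ∣ D.mat γ 0 1 ∧ (M * N : ℤ) ∣ D.mat γ 1 0 := by
  obtain ⟨u, v, huv⟩ := hA.pow_right (n := 2)
  obtain ⟨γ, hγ⟩ := D.mat_surjective
    ⟨!![A, -(M * N * v); M * N, u], by rw [Matrix.det_fin_two]; simp; linarith⟩
  refine ⟨γ, by rw [hγ]; rfl, ?_, ?_⟩ <;> rw [hγ]
  · exact ⟨-v, by simp⟩
  · exact ⟨1, by simp⟩

variable [NeZero M]

/-- A diagonal element `diag(A, A⁻¹)` modulo `MN` turns a character `ψ` into `x ↦ ψ (A² x)`. -/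
theorem sum_mul_sq_mem (hD : D.OddOrTrivial) {p k Ms : ℕ} (hp : p.Prime)
    (hM : M = p ^ k * Ms) (hk : 0 < k) (hpMs : p.Coprime Ms) (hMN : M.Coprime N)
    (hR : ∀ y : ZMod M, (Ms : ZMod M) * y ∈ D.periods)
    {W : Submodule ℂ U} (hW : D.Stable (Ms * N) W) {ψ : AddChar (ZMod M) ℂ}
    (hS : ∑ x, ψ x • D.F x ∈ W) {A : ℤ} (hA : IsCoprime A (M * N : ℤ))
    (hA1 : (Ms * N : ℤ) ∣ A - 1) : ∑ x, ψ ((A : ZMod M) ^ 2 * x) • D.F x ∈ W := by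
  classical
  obtain ⟨γ, h00, h01, h10⟩ := D.exists_diagonal hA
  have hpM : p ∣ M := hM ▸ (dvd_pow_self p hk.ne').mul_right Ms
  have hMsM : Ms ∣ M := hM ▸ Dvd.intro_left _ rfl
  have hMsN : (Ms * N : ℤ) ∣ M * N := mul_dvd_mul_right (by exact_mod_cast hMsM) _
  have c10 : (D.mat γ 1 0 : ZMod M) = 0 :=
    (ZMod.intCast_zmod_eq_zero_iff_dvd _ _).2 ((Dvd.intro _ rfl).trans h10)
  have c01 : (D.mat γ 0 1 : ZMod M) = 0 :=
    (ZMod.intCast_zmod_eq_zero_iff_dvd _ _).2 ((Dvd.intro _ rfl).trans h01)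
  have hdet := SL2_det_cast (D.mat γ) (ZMod M)
  rw [h00, c10, mul_zero, sub_zero] at hdet
  set E : ZMod M := (D.mat γ 1 1 : ZMod M)
  have hγ : D.mat γ ∈ Gamma (Ms * N) := by
    have k00 : (A : ZMod (Ms * N)) = 1 := by
      have := (ZMod.intCast_zmod_eq_zero_iff_dvd (A - 1) (Ms * N)).2 (by exact_mod_cast hA1)
      push_cast at this
      exact sub_eq_zero.1 this
    have k01 : (D.mat γ 0 1 : ZMod (Ms * N)) = 0 :=
      (ZMod.intCast_zmod_eq_zero_iff_dvd _ _).2 (by exact_mod_cast hMsN.trans h01)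
    have k10 : (D.mat γ 1 0 : ZMod (Ms * N)) = 0 :=
      (ZMod.intCast_zmod_eq_zero_iff_dvd _ _).2 (by exact_mod_cast hMsN.trans h10)
    have := SL2_det_cast (D.mat γ) (ZMod (Ms * N))
    rw [h00, k00, k10, mul_zero, sub_zero, one_mul] at this
    rw [Gamma_mem, h00]
    exact ⟨k00, k01, k10, this⟩
  have hAu : IsUnit (A : ZMod M) := IsUnit.of_mul_eq_one _ hdet
  have hden : ∀ x, rowDen M (D.mat γ) x = A := fun x => by simp [rowDen, h00, c10]
  have hadm : ∀ x, D.Adm γ x := fun x =>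
    ⟨Gamma_mono (Dvd.intro_left _ rfl) hγ, by rw [hden]; exact hAu⟩
  have hmv : ∀ x, D.mv γ x = E ^ 2 * x := fun x => move_eq (hadm x).2 (by
    rw [hden, rowNum, c01]
    linear_combination (E * x) * hdet)
  have hAR : ∀ y, (A : ZMod M) ^ 2 * y - y ∈ D.periods := fun y => by
    obtain ⟨t, ht⟩ := (Dvd.intro _ rfl : (Ms : ℤ) ∣ Ms * N).trans hA1
    have h : (A : ZMod M) ^ 2 * y - y = Ms * (t * (A + 1) * y) := by
      have := congrArg (Int.cast : ℤ → ZMod M) ht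
      push_cast at this
      linear_combination ((A + 1) * y : ZMod M) * this
    rw [h]
    exact hR _
  refine mem_of_sum_coset_mem D.periods fun x₀ => ?_
  have hsgn : ∀ x, x - x₀ ∈ D.periods → D.sgn γ x = D.sgn γ x₀ := fun x hx => by
    obtain ⟨m, hm⟩ := exists_mul_eq hMN (x - x₀)
    have e : x = x₀ + m * N := by rw [hm]; ring
    rw [e]
    refine sgn_add_eq hD hp hM hk hpMs hMN hγ (hm ▸ hx) ?_ (hadm _) (hadm _)
    refine Dvd.dvd.mul_left ?_ _
    exact (Int.natCast_dvd_natCast.2 hpM).trans ((Dvd.intro _ rfl).trans h10)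
  have h1 := hW γ hγ _ (sum_coset_mem (hW.mono (mul_dvd_mul_right hMsM N)) hMN hS x₀)
  have h2 : D.act γ (∑ x, (if x - x₀ ∈ D.periods then ψ x else 0) • D.F x) =
      ((D.sgn γ x₀ : ℤ) : ℂ) • ∑ x, (if x - x₀ ∈ D.periods then
        ψ ((A : ZMod M) ^ 2 * x) else 0) • D.F x := by
    rw [map_sum, Finset.smul_sum]
    let φ : ZMod M ≃ ZMod M :=
      { toFun := fun x => E ^ 2 * x
        invFun := fun x => (A : ZMod M) ^ 2 * x
        left_inv := fun x => by linear_combination (A * E + 1) * x * hdet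
        right_inv := fun x => by linear_combination (A * E + 1) * x * hdet }
    rw [← Equiv.sum_comp φ fun y => ((D.sgn γ x₀ : ℤ) : ℂ) • _]
    refine Finset.sum_congr rfl fun x _ => ?_
    have e : φ x = E ^ 2 * x := rfl
    have e' : (A : ZMod M) ^ 2 * (E ^ 2 * x) = x := φ.left_inv x
    have hiff : E ^ 2 * x - x₀ ∈ D.periods ↔ x - x₀ ∈ D.periods := by
      have := hAR (E ^ 2 * x)
      rw [e'] at this
      constructor
      · intro h; simpa using D.periods.add_mem this h
      · intro h; simpa using D.periods.sub_mem h this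
    rw [e, e', map_smul, (hadm x).act_F, hmv]
    by_cases hx : x - x₀ ∈ D.periods
    · rw [if_pos hx, if_pos (hiff.2 hx), hsgn x hx, smul_comm]
    · rw [if_neg hx, if_neg (mt hiff.1 hx), zero_smul, zero_smul, smul_zero]
  rw [h2] at h1
  have h3 := W.smul_mem ((D.sgn γ x₀ : ℤ) : ℂ) h1
  have h4 : ((D.sgn γ x₀ : ℤ) : ℂ) * ((D.sgn γ x₀ : ℤ) : ℂ) = 1 := by
    rcases Int.units_eq_one_or (D.sgn γ x₀) with h | h <;> simp [h]
  rwa [smul_smul, h4, one_smul] at h3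

/-- For `p ≥ 5` there is an integer `t` prime to `p` such that `p ^ m` is the exact power of `p`
dividing `t² - 1`.  For `p = 2` and `p = 3` this fails at `m = 0`. -/
theorem exists_sq_sub_one {p : ℕ} (hp : p.Prime) (h2 : p ≠ 2) (h3 : p ≠ 3) (m : ℕ) :
    ∃ t w : ℤ, ¬ (p : ℤ) ∣ t ∧ ¬ (p : ℤ) ∣ w ∧ t ^ 2 - 1 = p ^ m * w := by
  have hpr : ∀ q : ℕ, q.Prime → p ≠ q → ¬ (p : ℤ) ∣ q := fun q hq hpq h =>
    hpq ((Nat.prime_dvd_prime_iff_eq hp hq).1 (Int.natCast_dvd_natCast.1 h))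
  have n2 : ¬ (p : ℤ) ∣ 2 := hpr 2 Nat.prime_two h2
  rcases Nat.eq_zero_or_pos m with rfl | hm
  · exact ⟨2, 3, n2, hpr 3 Nat.prime_three h3, by norm_num⟩
  · have hd : (p : ℤ) ∣ p ^ m := dvd_pow_self _ hm.ne'
    refine ⟨1 + p ^ m, 2 + p ^ m, fun h => ?_, fun h => n2 ((dvd_add_left hd).1 h), by ring⟩
    exact hp.one_lt.ne' (Nat.dvd_one.1 (by exact_mod_cast (dvd_add_left hd).1 h))

/-! ### Twisting by a character of order `p` -/

/-- A submodule stable under the preimage of `Γ(Ms N)` that contains the vector attached to a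
character of `ℤ/Mℤ` contains the vector attached to a twist by a character of order `p`. -/
theorem exists_twist_mem (hD : D.OddOrTrivial) {p k Ms : ℕ} (hp : p.Prime)
    (hM : M = p ^ k * Ms) (hk : 0 < k) (hpMs : p.Coprime Ms) (hMN : M.Coprime N)
    {W : Submodule ℂ U} (hW : D.Stable (Ms * N) W) {ψ : AddChar (ZMod M) ℂ}
    (hψ : p = 2 ∨ p = 3 → ∀ y, ψ (Ms * y) = 1) (hS : ∑ x, ψ x • D.F x ∈ W) :
    ∃ θ : AddChar (ZMod M) ℂ, θ ≠ 1 ∧ (∀ x, θ x ^ p = 1) ∧ ∑ x, (ψ x * θ x) • D.F x ∈ W := by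
  classical
  have := Fact.mk hp
  have hpM : p ∣ M := hM ▸ (dvd_pow_self p hk.ne').mul_right Ms
  have hMsM : Ms ∣ M := hM ▸ Dvd.intro_left _ rfl
  have hWM := hW.mono (mul_dvd_mul_right hMsM N)
  set π := ZMod.castHom hpM (ZMod p) with hπ
  let θ : AddChar (ZMod M) ℂ := (ZMod.stdAddChar (N := p)).compAddMonoidHom π.toAddMonoidHom
  have hθ : ∀ x, θ x = ZMod.stdAddChar (π x) := fun _ => rfl
  have hθ1 : θ ≠ 1 := fun h => by
    have h1 : ZMod.stdAddChar (1 : ZMod p) = 1 := by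
      rw [← map_one π, ← hθ, h, AddChar.one_apply]
    exact one_ne_zero (ZMod.injective_stdAddChar (h1.trans (AddChar.map_zero_eq_one _).symm))
  have hθp : ∀ x, θ x ^ p = 1 := fun x => by
    rw [hθ, ← AddChar.map_nsmul_eq_pow]
    simp
  -- if all periods are multiples of `p`, every character of order `p` is constant on their cosets
  by_cases hR : ∀ n ∈ D.periods, π n = 0
  · refine ⟨θ, hθ1, hθp, sum_mul_mem hWM hMN hS fun x y hxy => ?_⟩
    have := hR _ hxy
    rw [map_sub, sub_eq_zero] at this
    rw [hθ, hθ, this]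
  push Not at hR
  obtain ⟨n, hn, hn0⟩ := hR
  have hR := mul_mem_of_castHom_ne_zero hp hM hpM D.periods hn hn0
  -- otherwise all multiples of `Ms` are periods
  by_cases hψ1 : ∀ y, ψ (Ms * y) = 1
  · refine ⟨θ, hθ1, hθp, mem_of_sum_coset_mem D.periods fun x₀ => ?_⟩
    exact sum_coset_twist_mem hD hp hM hk hpMs hMN hpM hMsM hR hW hψ1 x₀
      (sum_coset_mem hWM hMN hS x₀)
  -- `p ^ (m + 1)` is the order of the restriction of `ψ` to the multiples of `Ms`
  have hex : ∃ m, ∀ y, ψ (Ms * p ^ m * y) = 1 := ⟨k, fun y => by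
    have : (Ms * p ^ k : ZMod M) = 0 := by
      have := ZMod.natCast_self M
      rw [hM] at this ⊢
      push_cast at this
      linear_combination this
    rw [this, zero_mul, AddChar.map_zero_eq_one]⟩
  obtain ⟨m, hm1, hm2⟩ : ∃ m, (∀ y, ψ (Ms * p ^ (m + 1) * y) = 1) ∧
      ¬ ∀ y, ψ (Ms * p ^ m * y) = 1 := by
    have h0 : Nat.find hex ≠ 0 := fun h => hψ1 fun y => by
      simpa [h] using Nat.find_spec hex y
    obtain ⟨m, hm⟩ := Nat.exists_eq_succ_of_ne_zero h0
    exact ⟨m, by simpa [hm] using Nat.find_spec hex, Nat.find_min hex (by omega)⟩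
  have hmk : m < k := by
    by_contra! h
    refine hm2 fun y => ?_
    have : (Ms * p ^ m : ZMod M) = 0 := by
      obtain ⟨j, rfl⟩ := Nat.exists_eq_add_of_le h
      have := ZMod.natCast_self M
      rw [hM] at this ⊢
      push_cast at this
      linear_combination ((p : ZMod (p ^ k * Ms)) ^ j) * this
    rw [this, zero_mul, AddChar.map_zero_eq_one]
  have h23 : ¬ (p = 2 ∨ p = 3) := fun h => hψ1 (hψ h)
  push Not at h23
  obtain ⟨t, w, ht, hw, htw⟩ := exists_sq_sub_one hp h23.1 h23.2 m
  have hpp : Prime (p : ℤ) := Int.prime_iff_natAbs_prime.2 (by simpa using hp)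
  have hpMsN : p.Coprime (Ms * N) := hpMs.mul_right (hMN.coprime_dvd_left hpM)
  have hcop : IsCoprime ((p : ℤ) ^ k) (Ms * N : ℤ) :=
    (by exact_mod_cast Nat.isCoprime_iff_coprime.2 hpMsN : IsCoprime (p : ℤ) (Ms * N)).pow_left
  obtain ⟨A, hAt, hA1⟩ := Int.exists_dvd_sub_of_isCoprime hcop t 1
  have hAp : ¬ (p : ℤ) ∣ A := fun h => ht (by
    have := dvd_sub h ((dvd_pow_self (p : ℤ) hk.ne').trans hAt)
    rwa [sub_sub_cancel] at this)
  have hAMN : IsCoprime A (M * N : ℤ) := by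
    rw [hM]
    push_cast
    rw [mul_assoc]
    refine IsCoprime.mul_right ((hpp.coprime_iff_not_dvd.2 hAp).symm.pow_right) ?_
    obtain ⟨s, hs⟩ := hA1
    exact ⟨1, -s, by linarith⟩
  have hmem := sum_mul_sq_mem hD hp hM hk hpMs hMN hR hW hS hAMN hA1
  obtain ⟨w', hw', hAw⟩ : ∃ w' : ℤ, ¬ (p : ℤ) ∣ w' ∧ A ^ 2 - 1 = Ms * p ^ m * w' := by
    obtain ⟨s, hs⟩ := hAt
    obtain ⟨j, hj⟩ := Nat.exists_eq_add_of_lt hmk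
    -- `A² - 1` and `t² - 1` agree modulo a higher power of `p`
    have e1 : A ^ 2 - 1 = p ^ m * (w + p * (p ^ j * s * (A + t))) := by
      rw [hj] at hs
      linear_combination htw + (A + t) * hs
    have hd : (Ms : ℤ) ∣ p ^ m * (w + p * (p ^ j * s * (A + t))) := by
      rw [← e1]
      have : A ^ 2 - 1 = (A - 1) * (A + 1) := by ring
      rw [this]
      exact ((Dvd.intro _ rfl).trans hA1).mul_right _
    obtain ⟨w', hw'⟩ := ((Nat.isCoprime_iff_coprime.2 hpMs).symm.pow_right).dvd_of_dvd_mul_left hd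
    refine ⟨w', fun h => hw ?_, by rw [e1, hw']; ring⟩
    have := dvd_sub (h.mul_left (Ms : ℤ)) (Dvd.intro (p ^ j * s * (A + t)) rfl : (p : ℤ) ∣ _)
    rwa [← hw', add_sub_cancel_right] at this
  have hcast : (A : ZMod M) ^ 2 - 1 = Ms * p ^ m * w' := by exact_mod_cast congrArg _ hAw
  refine ⟨AddChar.mulShift ψ ((A : ZMod M) ^ 2 - 1), fun h => hm2 fun y => ?_, fun x => ?_, ?_⟩
  · obtain ⟨u, v, huv⟩ := (hpp.coprime_iff_not_dvd.2 hw')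
    have e : (Ms * p ^ m * y : ZMod M) =
        Ms * p ^ (m + 1) * (u * y) + ((A : ZMod M) ^ 2 - 1) * (v * y) := by
      have := congrArg (Int.cast : ℤ → ZMod M) huv
      push_cast at this
      rw [hcast]
      linear_combination (-(Ms * p ^ m * y : ZMod M)) * this
    rw [e, AddChar.map_add_eq_mul, hm1, ← AddChar.mulShift_apply, h, AddChar.one_apply, one_mul]
  · rw [AddChar.mulShift_apply, ← AddChar.map_nsmul_eq_pow, nsmul_eq_mul, hcast,
      ← hm1 (w' * x)]
    congr 1
    ring
  · convert hmem using 3 with x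
    rw [AddChar.mulShift_apply, ← AddChar.map_add_eq_mul]
    congr 1
    ring

end SignedAction

namespace Metaplectic

/-! ### Lifting integral matrices to the metaplectic group -/

theorem incl_apply (s : SL(2, ℤ)) (i j : Fin 2) :
    ((incl s : GL(2, ℝ)⁺) : GL (Fin 2) ℝ) i j = (s i j : ℝ) := rfl

theorem incl_injective : Function.Injective incl := by
  intro s t h
  ext i j
  have := congrArg (fun g : GL(2, ℝ)⁺ => (g : GL (Fin 2) ℝ) i j) h
  simp only [incl_apply] at this
  exact_mod_cast this

theorem denom_incl (s : SL(2, ℤ)) (τ : ℍ) :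
    denom (incl s : GL (Fin 2) ℝ) τ = (s 1 0 : ℂ) * τ + (s 1 1 : ℂ) := by
  have h : denom (incl s : GL (Fin 2) ℝ) τ =
      (((s 1 0 : ℤ) : ℝ) : ℂ) * τ + (((s 1 1 : ℤ) : ℝ) : ℂ) := rfl
  rw [h]
  simp

/-- The projection of `Mp₁(ℤ)` to `SL₂(ℤ)`. -/
noncomputable def toSL : MpZ →* SL(2, ℤ) :=
  MonoidHom.mk' (fun g => g.2.choose) fun a b => incl_injective (by
    rw [map_mul]
    exact (a * b).2.choose_spec.trans
      (congrArg₂ (· * ·) a.2.choose_spec.symm b.2.choose_spec.symm))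

theorem incl_toSL (g : MpZ) : incl (toSL g) = (g : GMp).mat := g.2.choose_spec

theorem toSL_eq {g : MpZ} {s : SL(2, ℤ)} (h : (g : GMp).mat = incl s) : toSL g = s :=
  incl_injective ((incl_toSL g).trans h)

/-- A continuous square root of `cτ + d` is given by the principal branch: unless `c = 0`, the
value `cτ + d` is never real. -/
theorem toSL_surjective : Function.Surjective toSL := by
  intro s
  let r : ℍ → ℂ := fun τ => ((s 1 0 : ℂ) * τ + (s 1 1 : ℂ)) ^ (((2 : ℕ) : ℂ)⁻¹)
  have hr : Continuous r := by
    by_cases h : s 1 0 = 0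
    · simp only [r, h, Int.cast_zero, zero_mul, zero_add]
      exact continuous_const
    · refine Continuous.cpow (by fun_prop) continuous_const fun τ => Or.inr ?_
      have him : ((s 1 0 : ℂ) * τ + (s 1 1 : ℂ)).im = s 1 0 * τ.im := by simp
      rw [him]
      exact mul_ne_zero (by exact_mod_cast h) τ.im_ne_zero
  refine ⟨⟨⟨incl s, r, hr, fun τ => ?_⟩, ⟨s, rfl⟩⟩, toSL_eq rfl⟩
  rw [denom_incl]
  exact Complex.cpow_nat_inv_pow _ two_ne_zero

theorem mem_tilde_iff {Γ : Subgroup SL(2, ℤ)} {g : MpZ} : g ∈ tilde Γ ↔ toSL g ∈ Γ := by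
  constructor
  · rintro ⟨s, hs, h⟩
    rwa [toSL_eq (g := g) h.symm]
  · intro h
    exact ⟨toSL g, h, incl_toSL g⟩

theorem mem_projSL_iff {Δ : Subgroup MpZ} {s : SL(2, ℤ)} :
    s ∈ projSL Δ ↔ ∃ g ∈ Δ, toSL g = s := by
  constructor
  · rintro ⟨g, hg, h⟩
    exact ⟨g, hg, toSL_eq h⟩
  · rintro ⟨g, hg, rfl⟩
    exact ⟨g, hg, (incl_toSL g).symm⟩

theorem toSL_T : toSL T = transl 1 := by
  refine toSL_eq ?_
  have : ModularGroup.T = transl 1 := by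
    ext i j
    fin_cases i <;> fin_cases j <;> simp [ModularGroup.T, transl]
  rw [← this]
  rfl

/-! ### The central element of order two -/

/-- The nontrivial element `(1, -1)` of the kernel of the projection to `SL₂(ℤ)`. -/
noncomputable def zc : MpZ :=
  ⟨{ mat := 1
     root := fun _ => -1
     continuous_root := continuous_const
     root_sq := fun τ => by simp }, ⟨1, map_one incl⟩⟩

theorem toSL_zc : toSL zc = 1 := toSL_eq (map_one incl).symm

theorem MpZ_ext {g k : MpZ} (h : toSL g = toSL k)
    (hr : ∀ τ, (g : GMp).root τ = (k : GMp).root τ) : g = k :=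
  Subtype.ext (GMp.ext (by rw [← incl_toSL, h, incl_toSL]) (funext hr))

theorem zc_mul_self : zc * zc = 1 :=
  MpZ_ext (by rw [map_mul, toSL_zc, map_one, one_mul]) fun τ => by simp [zc]

theorem zc_comm (g : MpZ) : zc * g = g * zc :=
  MpZ_ext (by rw [map_mul, map_mul, toSL_zc, one_mul, mul_one]) fun τ => by
    simp [zc]

/-- By connectedness of the upper half plane, a continuous square root of a constant is
constant. -/
theorem root_eq_or_neg {r : ℍ → ℂ} (hr : Continuous r) {c : ℂ} (hc : c ≠ 0)
    (h : ∀ τ, r τ ^ 2 = c ^ 2) : (∀ τ, r τ = c) ∨ ∀ τ, r τ = -c := by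
  rcases isPreconnected_univ.eq_or_eq_neg_of_sq_eq (f := r) (g := fun _ => c) hr.continuousOn
    continuousOn_const (fun τ _ => h τ) (fun _ => hc) with h | h
  · exact Or.inl fun τ => h (Set.mem_univ τ)
  · exact Or.inr fun τ => h (Set.mem_univ τ)

theorem eq_one_or_zc {g : MpZ} (h : toSL g = 1) : g = 1 ∨ g = zc := by
  have hsq : ∀ τ, (g : GMp).root τ ^ 2 = 1 ^ 2 := fun τ => by
    rw [(g : GMp).root_sq, ← incl_toSL, h, denom_incl]
    simp
  rcases root_eq_or_neg (g : GMp).continuous_root one_ne_zero hsq with h1 | h1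
  · exact Or.inl (MpZ_ext (by rw [h, map_one]) h1)
  · exact Or.inr (MpZ_ext (by rw [h, toSL_zc]) h1)

theorem eq_or_eq_mul_zc {g k : MpZ} (h : toSL g = toSL k) : g = k ∨ g = k * zc := by
  have : toSL (k⁻¹ * g) = 1 := by rw [map_mul, map_inv, h, inv_mul_cancel]
  rcases eq_one_or_zc this with h1 | h1
  · exact Or.inl (by rw [← mul_one k, ← h1, mul_inv_cancel_left])
  · exact Or.inr (by rw [← h1, mul_inv_cancel_left])

theorem incl_neg_one_smul (τ : ℍ) : incl (-1) • τ = τ := by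
  have h : incl (-1) • τ = (-1 : SL(2, ℤ)) • τ := rfl
  rw [h, ModularGroup.SL_neg_smul, one_smul]

/-- The elements over `-1` are central and square to `(1, -1)`. -/
theorem neg_one_lift {g : MpZ} (h : toSL g = -1) : g * g = zc ∧ ∀ k, g * k = k * g := by
  have hmat : (g : GMp).mat = incl (-1) := by rw [← incl_toSL, h]
  have hsq : ∀ τ, (g : GMp).root τ ^ 2 = Complex.I ^ 2 := fun τ => by
    rw [(g : GMp).root_sq, hmat, denom_incl]
    simp
  have hconst : ∃ c, ∀ τ, (g : GMp).root τ = c := by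
    rcases root_eq_or_neg (g : GMp).continuous_root Complex.I_ne_zero hsq with h1 | h1
    · exact ⟨_, h1⟩
    · exact ⟨_, h1⟩
  obtain ⟨c, hc⟩ := hconst
  constructor
  · refine MpZ_ext (by rw [map_mul, h, toSL_zc]; simp) fun τ => ?_
    have := hsq τ
    rw [hc, Complex.I_sq] at this
    show (g : GMp).root ((g : GMp).mat • τ) * (g : GMp).root τ = -1
    rw [hc, hc, ← sq, this]
  · intro k
    refine MpZ_ext (by rw [map_mul, map_mul, h]; simp) fun τ => ?_
    simp only [Subgroup.coe_mul, GMp.mul_root, hc, hmat, incl_neg_one_smul]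
    ring

/-! ### The central element acts trivially in odd level -/

theorem eq_one_of_conj_eq_mul_sq {Q : Type*} [Group Q] {s j c z : Q} (hz : s * s * (s * s) = z)
    (hj : s * j * s⁻¹ = j * (s * s) * c) (hcomm : s * s * j = j * (s * s)) (hc : c * s = s * c)
    (hc2 : c * c = 1) : z = 1 := by
  have h1 : s * (s * j * s⁻¹) * s⁻¹ = j := by
    have : s * (s * j * s⁻¹) * s⁻¹ = s * s * j * (s * s)⁻¹ := by group
    rw [this, hcomm, mul_inv_cancel_right]
  have h2 : s * (s * j * s⁻¹) * s⁻¹ = (s * j * s⁻¹) * (s * s) * c := by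
    have hc' : c * s⁻¹ = s⁻¹ * c := (Commute.inv_right (show Commute c s from hc)).eq
    rw [hj]
    calc s * (j * (s * s) * c) * s⁻¹ = s * (j * (s * s)) * (c * s⁻¹) := by group
      _ = s * (j * (s * s)) * (s⁻¹ * c) := by rw [hc']
      _ = (s * j * s⁻¹) * (s * s) * c := by group
      _ = _ := by rw [hj]
  have hc4 : c * (s * s) = s * s * c := by rw [← mul_assoc, hc, mul_assoc, hc, mul_assoc]
  rw [h1, hj] at h2
  have h3 : j * (s * s) * c * (s * s) * c = j * z := by
    calc j * (s * s) * c * (s * s) * c = j * (s * s) * (c * (s * s)) * c := by group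
      _ = j * (s * s * (s * s)) * (c * c) := by rw [hc4]; group
      _ = j * z := by rw [hc2, hz, mul_one]
  rw [h3] at h2
  exact (mul_eq_left.1 h2.symm)

/-- For odd `N` there is a matrix that anticommutes modulo `N` with `(0 -1; 1 0)`; a solution of
`a² + b² ≡ -1` modulo `N` comes from writing a prime as a sum of two squares. -/
theorem exists_anticommuting {N : ℕ} (hN : Odd N) :
    ∃ J : SL(2, ℤ), J⁻¹ * ModularGroup.S * J * ModularGroup.S⁻¹ * (-1)⁻¹ ∈ Gamma N := by
  have hN0 : NeZero N := ⟨hN.pos.ne'⟩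
  have hcop : IsCoprime (N : ℤ) 4 := by
    have : Nat.Coprime N 4 := Nat.Coprime.pow_right 2 (Nat.coprime_two_right.2 hN)
    exact_mod_cast Nat.isCoprime_iff_coprime.2 this
  obtain ⟨x, hxN, hx4⟩ := Int.exists_dvd_sub_of_isCoprime hcop (-1) 1
  have hunit : IsUnit ((x : ℤ) : ZMod (N * 4)) := by
    rw [ZMod.coe_int_isUnit_iff_isCoprime]
    push_cast
    refine IsCoprime.mul_left ?_ ?_
    · obtain ⟨t, ht⟩ := hxN; exact ⟨t, -1, by linarith⟩
    · obtain ⟨t, ht⟩ := hx4; exact ⟨-t, 1, by linarith⟩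
  obtain ⟨P, -, hP, hPx⟩ := Nat.forall_exists_prime_gt_and_eq_mod hunit 0
  have hPx' : ((N * 4 : ℕ) : ℤ) ∣ x - P :=
    (ZMod.intCast_eq_intCast_iff_dvd_sub (P : ℤ) x _).1 (by simpa using hPx)
  push_cast at hPx'
  have hP4 : (4 : ℤ) ∣ P - 1 := by
    have := dvd_sub hx4 ((Dvd.intro_left _ rfl : (4 : ℤ) ∣ N * 4).trans hPx')
    rwa [sub_sub_sub_cancel_left] at this
  have hPN : (N : ℤ) ∣ P + 1 := by
    have := dvd_sub hxN ((Dvd.intro _ rfl : (N : ℤ) ∣ N * 4).trans hPx')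
    rwa [sub_sub_sub_cancel_left, sub_neg_eq_add] at this
  have := Fact.mk hP
  obtain ⟨a, b, hab⟩ := Nat.Prime.sq_add_sq (p := P) (by omega)
  have hcopab : IsCoprime (a : ℤ) b := by
    rw [Nat.isCoprime_iff_coprime]
    have h1 : a.gcd b * a.gcd b ∣ P := by
      rw [← hab, sq, sq]
      exact dvd_add (mul_dvd_mul (Nat.gcd_dvd_left _ _) (Nat.gcd_dvd_left _ _))
        (mul_dvd_mul (Nat.gcd_dvd_right _ _) (Nat.gcd_dvd_right _ _))
    exact Nat.isUnit_iff.1 (hP.squarefree _ h1)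
  obtain ⟨u, v, huv⟩ := hcopab
  obtain ⟨r, hr⟩ := hPN
  have hab' : (a : ℤ) ^ 2 + (b : ℤ) ^ 2 = N * r - 1 := by
    have : ((a ^ 2 + b ^ 2 : ℕ) : ℤ) = P := congrArg _ hab
    push_cast at this
    linarith
  -- correct the determinant of `(a b; b -a)` modulo `N`
  let J : SL(2, ℤ) := ⟨!![(a : ℤ), b; b - N * (r * v), -a + N * (r * u)], by
    rw [Matrix.det_fin_two]
    simp
    linear_combination (N * r) * huv - hab'⟩
  have hn : (N : ZMod N) = 0 := ZMod.natCast_self N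
  have hab2 : (a : ZMod N) ^ 2 + (b : ZMod N) ^ 2 = -1 := by
    have := congrArg (Int.cast : ℤ → ZMod N) hab'
    push_cast at this
    rw [this, hn]
    ring
  refine ⟨J, ?_⟩
  have e : ∀ i j, J⁻¹ i j = !![-(a : ℤ) + N * (r * u), -b; -(b - N * (r * v)), a] i j :=
    fun i j => by rw [Matrix.SpecialLinearGroup.SL2_inv_expl]; rfl
  have eJ : ∀ i j, J i j = !![(a : ℤ), b; b - N * (r * v), -a + N * (r * u)] i j :=
    fun i j => rfl
  have eS : ∀ i j, ModularGroup.S i j = !![(0 : ℤ), -1; 1, 0] i j := fun i j => rfl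
  have eS' : ∀ i j, ModularGroup.S⁻¹ i j = !![(0 : ℤ), 1; -1, 0] i j := fun i j => by
    rw [Matrix.SpecialLinearGroup.SL2_inv_expl]
    fin_cases i <;> fin_cases j <;> simp [ModularGroup.S]
  have em : ((-1)⁻¹ : SL(2, ℤ)) = -1 := by rw [inv_neg, inv_one]
  have en : ∀ i j, (-1 : SL(2, ℤ)) i j = !![(-1 : ℤ), 0; 0, -1] i j := fun i j => by
    fin_cases i <;> fin_cases j <;> simp
  rw [em, Gamma_mem]
  simp only [SL2_mul_apply, e, eJ, eS, eS', en]
  refine ⟨?_, ?_, ?_, ?_⟩ <;> simp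
  · linear_combination -hab2
  · ring
  · ring
  · linear_combination -hab2

variable {V : Type*} [AddCommGroup V] [Module ℂ V]

theorem rho_mul (ρ : Representation ℂ (MpZ)ᵐᵒᵖ V) (g k : MpZ) (v : V) :
    ρ (MulOpposite.op (g * k)) v = ρ (MulOpposite.op k) (ρ (MulOpposite.op g) v) := by
  rw [MulOpposite.op_mul, map_mul, Module.End.mul_apply]

/-- An element over `Γ(N)` agrees with an element of the kernel up to the central element. -/
theorem exists_kernel_of_mem_Gamma {ρ : Representation ℂ (MpZ)ᵐᵒᵖ V} {N : ℕ}
    (hker : IsCongruenceOfLevel (kernel ρ) N) {δ : MpZ} (hδ : toSL δ ∈ Gamma N) :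
    ∃ κ ∈ kernel ρ, δ = κ ∨ δ = κ * zc := by
  obtain ⟨κ, hκ, h⟩ := mem_projSL_iff.1 (hker.1.2 hδ)
  exact ⟨κ, hκ, eq_or_eq_mul_zc h.symm⟩

/-- In odd level the central element `z = (1, -1)` acts trivially.  Let `s` lie over
`S = (0 -1; 1 0)` and `j` over a matrix anticommuting with `S` modulo `N`.  Then `s²` lies over
`-1`, hence is central with `(s²)² = z`, and modulo the kernel conjugation by `s` multiplies `j` by
`s²`, up to a power of `z`.  Conjugating twice multiplies `j` by `(s²)² = z`, but does nothing as
`s²` is central. -/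
theorem zc_mem_kernel {ρ : Representation ℂ (MpZ)ᵐᵒᵖ V} {N : ℕ}
    (hker : IsCongruenceOfLevel (kernel ρ) N) (hN : Odd N) : zc ∈ kernel ρ := by
  let φ : MpZ →* (Module.End ℂ V)ᵐᵒᵖ :=
    { toFun := fun g => MulOpposite.op (ρ (MulOpposite.op g))
      map_one' := by simp
      map_mul' := fun a b => by simp [MulOpposite.op_mul] }
  have hφ : ∀ g, φ.toHomUnits g = 1 ↔ g ∈ kernel ρ := fun g => by
    constructor
    · intro h v
      have h1 : φ g = 1 := congrArg Units.val h
      have h2 : ρ (MulOpposite.op g) = 1 := MulOpposite.op_injective h1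
      rw [h2, Module.End.one_apply]
    · intro h
      refine Units.ext ?_
      show MulOpposite.op (ρ (MulOpposite.op g)) = 1
      have h2 : ρ (MulOpposite.op g) = 1 := LinearMap.ext fun v => h v
      rw [h2, MulOpposite.op_one]
  set q := φ.toHomUnits
  obtain ⟨J, hJ⟩ := exists_anticommuting hN
  obtain ⟨s, hs⟩ := toSL_surjective ModularGroup.S
  obtain ⟨j, hj⟩ := toSL_surjective J
  have hss : toSL (s * s) = -1 := by
    rw [map_mul, hs]
    ext a b
    rw [SL2_mul_apply]
    fin_cases a <;> fin_cases b <;> simp [ModularGroup.S]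
  obtain ⟨h4, hcen⟩ := neg_one_lift hss
  set κ := j⁻¹ * s * j * s⁻¹ * (s * s)⁻¹ with hκ
  have hκN : toSL κ ∈ Gamma N := by
    rw [hκ, map_mul, map_mul, map_mul, map_mul, map_inv, map_inv, map_inv, hss, hs, hj]
    exact hJ
  have hcase : q κ = 1 ∨ q κ = q zc := by
    obtain ⟨κ', hκ', h | h⟩ := exists_kernel_of_mem_Gamma hker hκN
    · exact Or.inl (by rw [h, (hφ κ').2 hκ'])
    · exact Or.inr (by rw [h, map_mul, (hφ κ').2 hκ', one_mul])
  rw [← hφ]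
  refine eq_one_of_conj_eq_mul_sq (s := q s) (j := q j) (c := q κ) ?_ ?_ ?_ ?_ ?_
  · rw [← map_mul, ← map_mul, h4]
  · have : s * j * s⁻¹ = j * κ * (s * s) := by rw [hκ]; group
    rw [← map_mul, ← map_inv, ← map_mul, this, map_mul, map_mul, ← map_mul q s s, mul_assoc,
      mul_assoc]
    congr 1
    rw [← map_mul, ← map_mul, hcen]
  · rw [← map_mul, ← map_mul, ← map_mul, hcen]
  · rcases hcase with h | h
    · rw [h, one_mul, mul_one]
    · rw [h, ← map_mul, ← map_mul, zc_comm]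
  · rcases hcase with h | h
    · rw [h, one_mul]
    · rw [h, ← map_mul, zc_mul_self, map_one]

/-- The preimage of `Γ(N)` acts on `v` by signs, which are trivial unless `N` is even. -/
theorem rho_Gamma {ρ : Representation ℂ (MpZ)ᵐᵒᵖ V} {N : ℕ}
    (hker : IsCongruenceOfLevel (kernel ρ) N) {v : V} {u : ℂˣ}
    (hu : ρ (MulOpposite.op zc) v = (u : ℂ) • v) :
    (∀ δ, toSL δ ∈ Gamma N → ρ (MulOpposite.op δ) v = v) ∨
      Even N ∧ ∀ δ, toSL δ ∈ Gamma N → ρ (MulOpposite.op δ) v = v ∨ ρ (MulOpposite.op δ) v = -v := by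
  have h1 : ∀ δ, toSL δ ∈ Gamma N → ρ (MulOpposite.op δ) v = v ∨
      ρ (MulOpposite.op δ) v = ρ (MulOpposite.op zc) v := fun δ hδ => by
    obtain ⟨κ, hκ, rfl | rfl⟩ := exists_kernel_of_mem_Gamma hker hδ
    · exact Or.inl (hκ v)
    · exact Or.inr (by rw [rho_mul, hκ v])
  by_cases hv : ρ (MulOpposite.op zc) v = v
  · exact Or.inl fun δ hδ => (h1 δ hδ).elim id fun h => h.trans hv
  · refine Or.inr ⟨?_, ?_⟩
    · by_contra h
      exact hv (zc_mem_kernel hker (Nat.not_even_iff_odd.1 h) v)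
    · have h2 : ((u : ℂ) * u) • v = v := by
        rw [mul_smul, ← hu, ← map_smul, ← hu, ← rho_mul, zc_mul_self]
        simp
      have h3 : ρ (MulOpposite.op zc) v = -v := by
        have h4 : (((u : ℂ) - 1) * (u + 1)) • v = 0 := by
          have : ((u : ℂ) - 1) * (u + 1) = u * u - 1 := by ring
          rw [this, sub_smul, h2, one_smul, sub_self]
        have hu1 : (u : ℂ) - 1 ≠ 0 := fun h => hv (by rw [hu, sub_eq_zero.1 h, one_smul])
        rw [mul_smul, smul_eq_zero_iff_right hu1, add_smul, one_smul] at h4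
        rw [hu]
        exact eq_neg_of_add_eq_zero_left h4
      intro δ hδ
      rw [← h3]
      exact h1 δ hδ

end Metaplectic

namespace Metaplectic

/-! ### The vectors `v ⊗ u_x` in the Hecke module -/

section Cusp

variable {V : Type*} [AddCommGroup V] [Module ℂ V] {ρ : Representation ℂ (MpZ)ᵐᵒᵖ V} {M : ℕ}

variable (ρ) in
/-- The class of `v ⊗ u_x` in `T_M V`. -/
noncomputable def tmulClass (v : V) (x : GMpDet M) : Hecke ρ M :=
  (heckeRelations ρ M).mkQ (v ⊗ₜ[ℂ] Finsupp.single x 1)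

theorem heckeRep_tmulClass (g : MpZ) (v : V) (x : GMpDet M) :
    heckeRep ρ M (MulOpposite.op g) (tmulClass ρ v x) = tmulClass ρ v (rmul x g) := by
  show (heckeRelations ρ M).mkQ (preAction V M g (v ⊗ₜ[ℂ] Finsupp.single x 1)) = _
  rw [preAction_tmul_single]
  rfl

theorem tmulClass_lmul (g : MpZ) (v : V) (x : GMpDet M) :
    tmulClass ρ v (lmul g x) = tmulClass ρ (ρ (MulOpposite.op g) v) x :=
  ((Submodule.Quotient.eq (heckeRelations ρ M)).2 (Submodule.subset_span ⟨g, v, x, rfl⟩)).symm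

theorem tmulClass_smul (c : ℂ) (v : V) (x : GMpDet M) : tmulClass ρ (c • v) x = c • tmulClass ρ v x := by
  rw [tmulClass, ← TensorProduct.smul_tmul', map_smul]
  rfl

theorem tmulClass_neg (v : V) (x : GMpDet M) : tmulClass ρ (-v) x = -tmulClass ρ v x := by
  rw [tmulClass, TensorProduct.neg_tmul, map_neg]
  rfl

theorem lmul_injective (x : GMpDet M) : Function.Injective fun g : MpZ => lmul g x :=
  fun _ _ h => Subtype.ext (mul_right_cancel (congrArg Subtype.val h))

theorem lmul_lmul (g k : MpZ) (x : GMpDet M) : lmul g (lmul k x) = lmul (g * k) x :=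
  Subtype.ext (mul_assoc _ _ _).symm

/-- `Mp₁(ℤ)` acts freely on `GMp₁^(M)(ℤ)` from the left, so that `T_M V` contains a copy of `V` for
every orbit: the projection to it sends `v ⊗ u_y` to `vδ` if `y = δx`, and to `0` if `y` is not in
the orbit of `x`. -/
theorem tmulClass_ne_zero {v : V} (hv : v ≠ 0) (x : GMpDet M) : tmulClass ρ v x ≠ 0 := by
  classical
  let E : GMpDet M → Module.End ℂ V := fun y =>
    if h : ∃ δ, lmul δ x = y then ρ (MulOpposite.op h.choose) else 0
  have hE : ∀ δ, E (lmul δ x) = ρ (MulOpposite.op δ) := fun δ => by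
    have h : ∃ δ', lmul δ' x = lmul δ x := ⟨δ, rfl⟩
    simp only [E, dif_pos h]
    rw [lmul_injective x h.choose_spec]
  let L : V ⊗[ℂ] (GMpDet M →₀ ℂ) →ₗ[ℂ] V :=
    TensorProduct.lift (Finsupp.linearCombination ℂ E).flip
  have hL : ∀ w y, L (w ⊗ₜ[ℂ] Finsupp.single y 1) = E y w := fun w y => by simp [L]
  have hrel : heckeRelations ρ M ≤ LinearMap.ker L := by
    rw [heckeRelations, Submodule.span_le]
    rintro _ ⟨g, w, y, rfl⟩
    rw [SetLike.mem_coe, LinearMap.mem_ker, map_sub, hL, hL, sub_eq_zero]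
    by_cases h : ∃ δ, lmul δ x = y
    · obtain ⟨δ, rfl⟩ := h
      rw [lmul_lmul, hE, hE, rho_mul]
    · have h' : ¬ ∃ δ, lmul δ x = lmul g y := by
        rintro ⟨δ, hδ⟩
        refine h ⟨g⁻¹ * δ, ?_⟩
        rw [← lmul_lmul, hδ, lmul_lmul, inv_mul_cancel]
        exact Subtype.ext (one_mul _)
      simp only [E, dif_neg h, dif_neg h', LinearMap.zero_apply]
  intro h0
  have h1 : L (v ⊗ₜ[ℂ] Finsupp.single x 1) = 0 := hrel ((Submodule.Quotient.mk_eq_zero _).1 h0)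
  have h2 : lmul 1 x = x := Subtype.ext (one_mul _)
  rw [hL, ← h2, hE] at h1
  exact hv (by simpa using h1)

end Cusp

/-! ### Multiplying upper triangular matrices by the metaplectic group -/

section Upper

variable {M : ℕ} [NeZero M]

theorem upper_apply (h : ℤ) (i j : Fin 2) :
    (((upper M h).1.mat : GL(2, ℝ)⁺) : GL (Fin 2) ℝ) i j = !![(1 : ℝ), h; 0, M] i j := rfl

theorem GLPos_ext {g k : GL(2, ℝ)⁺}
    (h : ∀ i j, (g : GL (Fin 2) ℝ) i j = (k : GL (Fin 2) ℝ) i j) : g = k :=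
  Subtype.ext (Units.ext (Matrix.ext h))

theorem GLPos_mul_apply (g k : GL(2, ℝ)⁺) (i j : Fin 2) :
    ((g * k : GL(2, ℝ)⁺) : GL (Fin 2) ℝ) i j =
      (g : GL (Fin 2) ℝ) i 0 * (k : GL (Fin 2) ℝ) 0 j +
        (g : GL (Fin 2) ℝ) i 1 * (k : GL (Fin 2) ℝ) 1 j := by
  rw [Subgroup.coe_mul, Units.val_mul, Matrix.mul_apply, Fin.sum_univ_two]

theorem T_mat : ((T : MpZ) : GMp).mat = incl (transl 1) := by rw [← incl_toSL, toSL_T]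

theorem rmul_upper_T (h : ℤ) : rmul (upper M h) T = upper M (h + 1) := by
  refine Subtype.ext (GMp.ext (GLPos_ext fun i j => ?_) (funext fun τ => mul_one _))
  show ((((upper M h).1.mat * ((T : MpZ) : GMp).mat : GL(2, ℝ)⁺)) : GL (Fin 2) ℝ) i j = _
  rw [GLPos_mul_apply, T_mat]
  simp only [incl_apply, upper_apply]
  fin_cases i <;> fin_cases j <;> simp [add_comm]

theorem lmul_T_upper (h : ℤ) : lmul T (upper M h) = upper M (h + M) := by
  refine Subtype.ext (GMp.ext (GLPos_ext fun i j => ?_) (funext fun τ => one_mul _))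
  show (((((T : MpZ) : GMp).mat * (upper M h).1.mat : GL(2, ℝ)⁺)) : GL (Fin 2) ℝ) i j = _
  rw [GLPos_mul_apply, T_mat]
  simp only [incl_apply, upper_apply]
  fin_cases i <;> fin_cases j <;> simp

/-- The factorization `(1 h; 0 M) g = δ (1 h'; 0 M)`. -/
theorem exists_rmul_upper_eq (g : MpZ) {h h' t : ℤ}
    (ht : toSL g 0 1 + toSL g 1 1 * h - (toSL g 0 0 + toSL g 1 0 * h) * h' = M * t) :
    ∃ δ : MpZ, toSL δ 0 0 = toSL g 0 0 + toSL g 1 0 * h ∧ toSL δ 0 1 = t ∧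
      toSL δ 1 0 = M * toSL g 1 0 ∧ toSL δ 1 1 = toSL g 1 1 - toSL g 1 0 * h' ∧
      rmul (upper M h) g = lmul δ (upper M h') := by
  let s : SL(2, ℤ) := ⟨!![toSL g 0 0 + toSL g 1 0 * h, t; M * toSL g 1 0,
    toSL g 1 1 - toSL g 1 0 * h'], by
      rw [Matrix.det_fin_two]
      simp only [Matrix.of_apply, Matrix.cons_val', Matrix.cons_val_zero, Matrix.cons_val_one,
        Matrix.cons_val_fin_one]
      linear_combination SL2_det (toSL g) + toSL g 1 0 * ht⟩
  have hs : ∀ i j, s i j = !![toSL g 0 0 + toSL g 1 0 * h, t; M * toSL g 1 0,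
    toSL g 1 1 - toSL g 1 0 * h'] i j := fun i j => rfl
  have ht' : ((toSL g 0 1 : ℝ) + toSL g 1 1 * h - (toSL g 0 0 + toSL g 1 0 * h) * h') = M * t := by
    exact_mod_cast congrArg (Int.cast : ℤ → ℝ) ht
  have hmat : (upper M h).1.mat * (g : GMp).mat = incl s * (upper M h').1.mat := by
    refine GLPos_ext fun i j => ?_
    rw [GLPos_mul_apply, GLPos_mul_apply, ← incl_toSL]
    simp only [incl_apply, upper_apply, hs]
    fin_cases i <;> fin_cases j <;> simp
    · ring
    · linear_combination ht'
    · ring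
  have hδ : ((upper M h).1 * (g : GMp) * (upper M h').1⁻¹).mat = incl s := by
    show (upper M h).1.mat * (g : GMp).mat * (upper M h').1.mat⁻¹ = incl s
    rw [hmat, mul_inv_cancel_right]
  let δ : MpZ := ⟨(upper M h).1 * (g : GMp) * (upper M h').1⁻¹, ⟨s, hδ.symm⟩⟩
  have hδs : toSL δ = s := toSL_eq hδ
  refine ⟨δ, ?_, ?_, ?_, ?_, ?_⟩
  · rw [hδs]; rfl
  · rw [hδs]; rfl
  · rw [hδs]; rfl
  · rw [hδs]; rfl
  · exact Subtype.ext (inv_mul_cancel_right _ _).symm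

/-- If `h` and `h'` are divisible by `n`, factorization preserves the preimage of `Γ(n)`. -/
theorem exists_rmul_upper_eq_of_mem {n : ℕ} (hMn : M.Coprime n) {g : MpZ} (hg : toSL g ∈ Gamma n)
    {h h' : ℤ} (hn : (n : ℤ) ∣ h) (hn' : (n : ℤ) ∣ h')
    (hM : rowDen M (toSL g) h * (h' : ZMod M) = rowNum M (toSL g) h) :
    ∃ δ : MpZ, toSL δ ∈ Gamma n ∧ rmul (upper M h) g = lmul δ (upper M h') := by
  have hdvd : (M : ℤ) ∣ toSL g 0 1 + toSL g 1 1 * h - (toSL g 0 0 + toSL g 1 0 * h) * h' := by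
    rw [← ZMod.intCast_zmod_eq_zero_iff_dvd]
    push_cast
    simp only [rowDen, rowNum] at hM
    rw [hM, sub_self]
  obtain ⟨t, ht⟩ := hdvd
  obtain ⟨δ, h00, h01, h10, h11, hδ⟩ := exists_rmul_upper_eq g ht
  refine ⟨δ, ?_, hδ⟩
  rw [Gamma_mem] at hg ⊢
  obtain ⟨g00, g01, g10, g11⟩ := hg
  have hh : (h : ZMod n) = 0 := (ZMod.intCast_zmod_eq_zero_iff_dvd _ _).2 hn
  have hh' : (h' : ZMod n) = 0 := (ZMod.intCast_zmod_eq_zero_iff_dvd _ _).2 hn'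
  have hMunit : IsUnit (M : ZMod n) := (ZMod.isUnit_iff_coprime M n).2 hMn
  rw [h00, h01, h10, h11]
  refine ⟨?_, ?_, ?_, ?_⟩
  · push_cast; rw [g00, g10, zero_mul, add_zero]
  · have := congrArg (Int.cast : ℤ → ZMod n) ht
    push_cast at this
    rw [g01, hh, hh'] at this
    refine hMunit.mul_left_cancel ?_
    rw [← this]
    ring
  · push_cast; rw [g10, mul_zero]
  · push_cast; rw [g11, g10, zero_mul, sub_zero]

end Upper

/-! ### The signed action on the Hecke module -/

/-- An integer divisible by `n` that represents the class `x` modulo `M`. -/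
def rep (M n : ℕ) (x : ZMod M) : ℤ := n * ((x * (n : ZMod M)⁻¹).val : ℤ)

theorem dvd_rep {M : ℕ} (n : ℕ) (x : ZMod M) : (n : ℤ) ∣ rep M n x := Dvd.intro _ rfl

section Signed

variable {V : Type*} [AddCommGroup V] [Module ℂ V] {ρ : Representation ℂ (MpZ)ᵐᵒᵖ V}
  {M : ℕ} [NeZero M] {v : V} {c : ℂ}

theorem tmulClass_upper_add_mul (hT : ρ (MulOpposite.op T) v = c • v) (h : ℤ) (t : ℕ) :
    tmulClass ρ v (upper M (h + t * M)) = c ^ t • tmulClass ρ v (upper M h) := by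
  induction t with
  | zero => simp
  | succ t ih =>
    have : h + ((t + 1 : ℕ) : ℤ) * M = h + t * M + M := by push_cast; ring
    rw [this, ← lmul_T_upper, tmulClass_lmul, hT, tmulClass_smul, ih, smul_smul, pow_succ']

theorem heckeRep_T_pow_tmulClass (h : ℤ) (t : ℕ) :
    heckeRep ρ M (MulOpposite.op (T ^ t)) (tmulClass ρ v (upper M h)) = tmulClass ρ v (upper M (h + t)) := by
  induction t with
  | zero => simp
  | succ t ih =>
    rw [pow_succ, rho_mul, ih, heckeRep_tmulClass, rmul_upper_T]
    congr 2
    push_cast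
    ring

theorem rep_cast {n : ℕ} (hMn : M.Coprime n) (x : ZMod M) : (rep M n x : ZMod M) = x := by
  rw [rep]
  push_cast
  rw [ZMod.natCast_zmod_val, mul_left_comm, ZMod.coe_mul_inv_eq_one _ hMn.symm, mul_one]

/-- Among the multiples `h` of `n`, the vector `v ⊗ u_{(1 h; 0 M)}` depends only on `h` modulo
`M`. -/
theorem tmulClass_upper_eq {n : ℕ} (hMn : M.Coprime n) (hT : ρ (MulOpposite.op T) v = c • v)
    (hc : c ^ n = 1) {h h' : ℤ} (hn : (n : ℤ) ∣ h) (hn' : (n : ℤ) ∣ h')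
    (hh : (h : ZMod M) = h') : tmulClass ρ v (upper M h) = tmulClass ρ v (upper M h') := by
  wlog hle : h ≤ h' generalizing h h'
  · exact (this hn' hn hh.symm (le_of_not_ge hle)).symm
  have hM : (M : ℤ) ∣ h' - h := (ZMod.intCast_eq_intCast_iff_dvd_sub _ _ _).1 hh
  obtain ⟨t, ht⟩ := (Nat.isCoprime_iff_coprime.2 hMn).mul_dvd hM (dvd_sub hn' hn)
  have hM0 : (0 : ℤ) < M := by exact_mod_cast Nat.pos_of_ne_zero (NeZero.ne M)
  rcases Nat.eq_zero_or_pos n with rfl | hn0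
  · rw [show h' = h by simpa [sub_eq_zero] using ht]
  · have hn0' : (0 : ℤ) < n := by exact_mod_cast hn0
    have ht0 : 0 ≤ t := by
      by_contra hneg
      have : (M : ℤ) * n * t < 0 := mul_neg_of_pos_of_neg (mul_pos hM0 hn0') (not_le.1 hneg)
      omega
    lift t to ℕ using ht0
    have : h' = h + ((n * t : ℕ) : ℤ) * M := by push_cast; linear_combination ht
    rw [this, tmulClass_upper_add_mul hT, pow_mul, hc, one_pow, one_smul]

/-- The image of `v ⊗ u_{(1 h; 0 M)}` under the preimage of `Γ(n)`. -/
theorem exists_heckeRep_tmulClass_eq {n : ℕ} (hMn : M.Coprime n) {g : MpZ} (hg : toSL g ∈ Gamma n)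
    (v : V) {x y : ZMod M} (h : rowDen M (toSL g) x * y = rowNum M (toSL g) x) :
    ∃ δ : MpZ, toSL δ ∈ Gamma n ∧
      heckeRep ρ M (MulOpposite.op g) (tmulClass ρ v (upper M (rep M n x))) =
        tmulClass ρ (ρ (MulOpposite.op δ) v) (upper M (rep M n y)) := by
  obtain ⟨δ, hδ, h'⟩ := exists_rmul_upper_eq_of_mem hMn hg (dvd_rep n x) (dvd_rep n y)
    (by rwa [rep_cast hMn, rep_cast hMn])
  exact ⟨δ, hδ, by rw [heckeRep_tmulClass, h', tmulClass_lmul]⟩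

/-- The signed action spanned by the vectors `v ⊗ u_{(1 h; 0 M)}` in `T_M V`, if the preimage of
`Γ(n)` acts on `v` by signs and `Tⁿ` fixes `v`. -/
noncomputable def signedAction {n : ℕ} (hMn : M.Coprime n) (hv : v ≠ 0)
    (hT : ρ (MulOpposite.op T) v = c • v) (hc : c ^ n = 1)
    (hsign : ∀ δ, toSL δ ∈ Gamma n → ρ (MulOpposite.op δ) v = v ∨ ρ (MulOpposite.op δ) v = -v) :
    SignedAction M n MpZ (Hecke ρ M) where
  mat := toSL
  mat_surjective := toSL_surjective
  rep := heckeRep ρ M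
  F x := tmulClass ρ v (upper M (rep M n x))
  F_ne_zero x := tmulClass_ne_zero hv _
  tr := T ^ n
  mat_tr := by rw [map_pow, toSL_T, transl_pow, mul_one]
  tr_F x := by
    rw [heckeRep_T_pow_tmulClass]
    refine tmulClass_upper_eq hMn hT hc (dvd_add (dvd_rep n x) dvd_rfl) (dvd_rep n _) ?_
    push_cast
    rw [rep_cast hMn, rep_cast hMn]
  sign_F g hg x y _ h := by
    obtain ⟨δ, hδ, h'⟩ := exists_heckeRep_tmulClass_eq (ρ := ρ) hMn hg v h
    rw [h']
    rcases hsign δ hδ with h1 | h1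
    · exact Or.inl (by rw [h1])
    · exact Or.inr (by rw [h1, tmulClass_neg])

theorem sgn_signedAction_eq_one {n : ℕ} (hMn : M.Coprime n) (hv : v ≠ 0)
    (hT : ρ (MulOpposite.op T) v = c • v) (hc : c ^ n = 1)
    (hsign : ∀ δ, toSL δ ∈ Gamma n → ρ (MulOpposite.op δ) v = v ∨ ρ (MulOpposite.op δ) v = -v)
    (htriv : ∀ δ, toSL δ ∈ Gamma n → ρ (MulOpposite.op δ) v = v) {g : MpZ} {x : ZMod M}
    (h : (signedAction hMn hv hT hc hsign).Adm g x) :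
    (signedAction hMn hv hT hc hsign).sgn g x = 1 := by
  obtain ⟨δ, hδ, h'⟩ := exists_heckeRep_tmulClass_eq (ρ := ρ) hMn h.1 v (rowDen_mul_move h.2)
  rw [htriv δ hδ] at h'
  refine SignedAction.sgn_eq_of_smul h rfl ?_
  rw [Units.val_one, Int.cast_one, one_smul]
  exact h'

end Signed

end Metaplectic

namespace Metaplectic

/-! ### The vectors `v_T(M, b; α)` -/

theorem e_add (r s : ℚ) : e (r + s) = e r * e s := by
  rw [e, e, e, ← Complex.exp_add]
  push_cast
  ring_nf

theorem e_pow (r : ℚ) (n : ℕ) : e r ^ n = e (r * n) := by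
  rw [e, e, ← Complex.exp_nat_mul]
  push_cast
  ring_nf

theorem e_eq_one_iff (r : ℚ) : e r = 1 ↔ ∃ n : ℤ, r = n := by
  have h2 : 2 * Real.pi * Complex.I ≠ 0 := Complex.two_pi_I_ne_zero
  rw [e, Complex.exp_eq_one_iff]
  refine exists_congr fun n => ?_
  rw [mul_comm (n : ℂ), mul_right_inj' h2]
  exact_mod_cast Iff.rfl

theorem e_div_natCast (M : ℕ) [NeZero M] (j : ℤ) : e (j / M) = ZMod.stdAddChar (j : ZMod M) := by
  rw [ZMod.stdAddChar_coe, e]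
  push_cast
  ring_nf

/-- A sum over `0 ≤ h < M` of an `M`-periodic function may be taken over any representatives. -/
theorem sum_range_eq_sum_rep {A : Type*} [AddCommMonoid A] {M : ℕ} [NeZero M] {f : ℤ → A}
    (hf : ∀ h, f (h + M) = f h) {r : ZMod M → ℤ} (hr : ∀ x, (r x : ZMod M) = x) :
    ∑ h ∈ Finset.range M, f h = ∑ x : ZMod M, f (r x) := by
  have hf' : ∀ (t : ℤ) (h : ℤ), f (h + t * M) = f h := fun t h => by
    have : Function.Periodic f (M : ℤ) := hf
    simpa using (this.int_mul t) h
  have hcongr : ∀ h h' : ℤ, (h : ZMod M) = h' → f h = f h' := fun h h' hh => by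
    obtain ⟨t, ht⟩ := (ZMod.intCast_eq_intCast_iff_dvd_sub _ _ _).1 hh
    rw [← hf' t h]
    congr 1
    linear_combination -ht
  refine Finset.sum_bij' (fun h _ => (h : ZMod M)) (fun x _ => x.val) ?_ ?_ ?_ ?_ ?_
  · simp
  · intro x _
    exact Finset.mem_range.2 (ZMod.val_lt x)
  · intro h hh
    exact ZMod.val_cast_of_lt (Finset.mem_range.1 hh)
  · intro x _
    exact ZMod.natCast_zmod_val x
  · intro h _
    exact hcongr _ _ (by rw [hr]; simp)

variable {V : Type*} [AddCommGroup V] [Module ℂ V] {ρ : Representation ℂ (MpZ)ᵐᵒᵖ V}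
  {M : ℕ} {v : V} {α : ℚ}

/-- The vector `v_T(M, b; α)` as a combination of the vectors `v ⊗ u_{(1 h; 0 M)}`, with `h` running
through multiples of `n`; the coefficients form an additive character of `ℤ/Mℤ`. -/
theorem vT_eq [NeZero M] {n : ℕ} (hMn : M.Coprime n) (hT : ρ (MulOpposite.op T) v = e α • v) {b B : ℤ}
    (hB : (B : ℚ) = (b + α) * n) :
    vT ρ M b α v = ∑ x : ZMod M, (ZMod.stdAddChar (-(B : ZMod M) * (n : ZMod M)⁻¹ * x) : ℂ) •
      tmulClass ρ v (upper M (rep M n x)) := by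
  have hM0 : (M : ℚ) ≠ 0 := Nat.cast_ne_zero.2 (NeZero.ne M)
  let f : ℤ → Hecke ρ M := fun h => e (-((b + α) * h / M)) • tmulClass ρ v (upper M h)
  have h1 : vT ρ M b α v = ∑ h ∈ Finset.range M, f h := by
    rw [vT, TensorProduct.tmul_sum, map_sum]
    refine Finset.sum_congr rfl fun h _ => ?_
    simp only [f, tmulClass]
    rw [← map_smul, ← TensorProduct.tmul_smul, Finsupp.smul_single, smul_eq_mul, mul_one]
    push_cast
    rfl
  have hf : ∀ h, f (h + M) = f h := fun h => by
    simp only [f]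
    rw [← lmul_T_upper, tmulClass_lmul, hT, tmulClass_smul, smul_smul, ← e_add]
    congr 1
    have : -((b + α) * ((h + M : ℤ) : ℚ) / M) + α = -((b + α) * h / M) + ((-b : ℤ) : ℚ) := by
      push_cast
      field_simp
      ring
    rw [this, e_add, (e_eq_one_iff _).2 ⟨_, rfl⟩, mul_one]
  rw [h1, sum_range_eq_sum_rep hf (rep_cast hMn)]
  refine Finset.sum_congr rfl fun x _ => ?_
  simp only [f]
  congr 1
  have h2 : -((b + α) * ((rep M n x : ℤ) : ℚ) / M) =
      ((-B * ((x * (n : ZMod M)⁻¹).val : ℤ) : ℤ) : ℚ) / M := by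
    rw [rep]
    push_cast
    rw [hB]
    ring
  rw [h2, e_div_natCast]
  push_cast
  rw [ZMod.natCast_zmod_val]
  ring_nf

/-- The characters of `ℤ/Mℤ` of order `p`. -/
theorem exists_eq_stdAddChar [NeZero M] {p : ℕ} (hp : p.Prime) (hpM : p ∣ M) {θ : AddChar (ZMod M) ℂ}
    (hθ : θ ≠ 1) (hθp : ∀ x, θ x ^ p = 1) :
    ∃ u : ℤ, IsCoprime u (p : ℤ) ∧
      ∀ x, θ x = ZMod.stdAddChar (-((u * (M / p : ℕ) : ℤ) : ZMod M) * x) := by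
  have hp0 : NeZero p := ⟨hp.ne_zero⟩
  obtain ⟨k, -, hk⟩ := (Complex.isPrimitiveRoot_exp p hp.ne_zero).eq_pow_of_pow_eq_one (hθp 1)
  have hpC : (p : ℂ) ≠ 0 := Nat.cast_ne_zero.2 hp.ne_zero
  have hmul : ((M / p : ℕ) : ℂ) * p = M := by exact_mod_cast Nat.div_mul_cancel hpM
  generalize M / p = m at hmul ⊢
  have hMp : (m : ℂ) ≠ 0 := fun h => by
    rw [h, zero_mul] at hmul
    exact NeZero.ne M (by exact_mod_cast hmul.symm)
  have hθ1 : θ 1 = ZMod.stdAddChar ((k * m : ℤ) : ZMod M) := by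
    rw [← hk, ZMod.stdAddChar_coe, ← Complex.exp_nat_mul]
    congr 1
    push_cast
    rw [← hmul]
    field_simp
  refine ⟨-k, ?_, fun x => ?_⟩
  · rw [IsCoprime.neg_left_iff, Nat.isCoprime_iff_coprime]
    refine ((Nat.Prime.coprime_iff_not_dvd hp).2 fun ⟨l, hl⟩ => ?_).symm
    refine (AddChar.zmod_char_ne_one_iff M θ).1 hθ ?_
    rw [← hk, hl, pow_mul, (Complex.isPrimitiveRoot_exp p hp.ne_zero).pow_eq_one, one_pow]
  · have h3 : ∀ m : ℕ, θ (m : ZMod M) = θ 1 ^ m := fun m => by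
      rw [← AddChar.map_nsmul_eq_pow, nsmul_one]
    have h4 : ∀ (y : ZMod M) (m : ℕ),
        (ZMod.stdAddChar (y * (m : ZMod M)) : ℂ) = ZMod.stdAddChar y ^ m := fun y m => by
      rw [← AddChar.map_nsmul_eq_pow, nsmul_eq_mul, mul_comm]
    rw [← ZMod.natCast_zmod_val x, h3, h4, hθ1]
    push_cast
    simp

/-- A level `n` at which the vector `v` is fixed up to signs and `Tⁿ` fixes `v`: it is `N`, or `2N` if
nontrivial signs occur, in which case `N` is even. -/
theorem exists_level {N : ℕ} (hMN : M.Coprime N) (hker : IsCongruenceOfLevel (kernel ρ) N) {u : ℂˣ}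
    (hu : ρ (MulOpposite.op zc) v = (u : ℂ) • v) :
    ∃ n : ℕ, N ∣ n ∧ M.Coprime n ∧ ρ (MulOpposite.op (T ^ n)) v = v ∧
      (∀ δ, toSL δ ∈ Gamma n → ρ (MulOpposite.op δ) v = v ∨ ρ (MulOpposite.op δ) v = -v) ∧
      (Odd M ∨ ∀ δ, toSL δ ∈ Gamma n → ρ (MulOpposite.op δ) v = v) := by
  have hTN : toSL (T ^ N) ∈ Gamma N := by
    rw [map_pow, toSL_T, transl_pow, mul_one]
    exact transl_mem_Gamma dvd_rfl
  rcases rho_Gamma hker hu with h | ⟨hev, h⟩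
  · exact ⟨N, dvd_rfl, hMN, h _ hTN, fun δ hδ => Or.inl (h δ hδ), Or.inr h⟩
  · have hodd : Odd M := by
      by_contra hM
      exact Nat.not_coprime_of_dvd_of_dvd one_lt_two (Nat.not_odd_iff_even.1 hM).two_dvd
        hev.two_dvd hMN
    refine ⟨N * 2, Dvd.intro _ rfl,
      hMN.mul_right (Nat.coprime_two_right.2 hodd), ?_,
      fun δ hδ => h δ (Gamma_mono (Dvd.intro _ rfl) hδ), Or.inl hodd⟩
    rw [pow_mul, sq, rho_mul]
    rcases h _ hTN with h1 | h1
    · rw [h1, h1]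
    · rw [h1, map_neg, h1, neg_neg]

/-- If `αn` is an integer, the numerator of `α` divides it. -/
theorem dvd_of_mul_natCast_eq {n : ℕ} {A d : ℤ} (h : α * n = A) (hd : d ∣ α.num) : d ∣ A := by
  have h1 : α.num * n = A * α.den := by
    have h2 : ((α.num * n : ℤ) : ℚ) = ((A * α.den : ℤ) : ℚ) := by
      push_cast
      rw [← h, ← Rat.mul_den_eq_num α]
      ring
    exact_mod_cast h2
  have hcop : IsCoprime (α.den : ℤ) α.num := Int.isCoprime_iff_gcd_eq_one.2 α.reduced.symm
  obtain ⟨t, ht⟩ := hcop.dvd_of_dvd_mul_left (Dvd.intro_left _ h1.symm)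
  have h3 : A = α.num * t := by
    refine mul_right_cancel₀ (Int.natCast_ne_zero.2 α.den_nz) ?_
    rw [← h1, ht]
    ring
  rw [h3]
  exact hd.mul_right t

theorem rho_T_pow {c : ℂ} (hT : ρ (MulOpposite.op T) v = c • v) (n : ℕ) :
    ρ (MulOpposite.op (T ^ n)) v = c ^ n • v := by
  induction n with
  | zero => simp
  | succ n ih => rw [pow_succ, rho_mul, ih, map_smul, hT, smul_smul, pow_succ]

end Metaplectic

/-! ### The twisted vector -/

theorem mainTheorem8 {V : Type*} [AddCommGroup V] [Module ℂ V] [FiniteDimensional ℂ V]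
    (ρ : Representation ℂ (Metaplectic.MpZ)ᵐᵒᵖ V)
    (M N : ℕ) [NeZero M] (hN : 0 < N) (hMN : Nat.Coprime M N)
    (hker : Metaplectic.IsCongruenceOfLevel (Metaplectic.kernel ρ) N)
    (p Mp Ms : ℕ) (hp : p.Prime) (hpM : p ∣ M)
    (hM : M = Mp * Ms) (hMp : Mp ∣ p ^ 4) (hMs : Nat.Coprime p Ms)
    (W : Submodule ℂ (Metaplectic.Hecke ρ M))
    (hW : ∀ γ ∈ Metaplectic.tilde (Gamma (Ms * N)), ∀ w ∈ W,
      Metaplectic.heckeRep ρ M (MulOpposite.op γ) w ∈ W)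
    (v : V) (hv : v ≠ 0) (α : ℚ)
    (hvT : ρ (MulOpposite.op Metaplectic.T) v = Metaplectic.e α • v)
    (hvN : ∃ χ : Metaplectic.tilde (Gamma0 N) →* ℂˣ, ∀ γ : Metaplectic.tilde (Gamma0 N),
      ρ (MulOpposite.op (γ : Metaplectic.MpZ)) v = (χ γ : ℂ) • v)
    (b : ℤ) (hb : (Mp : ℤ) ∣ b)
    (hα : p = 2 ∨ p = 3 → (Mp : ℤ) ∣ α.num)
    (hbW : Metaplectic.vT ρ M b α v ∈ W) :
    ∃ u : ℤ, IsCoprime u (p : ℤ) ∧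
      Metaplectic.vT ρ M (b + u * ((M / p : ℕ) : ℤ)) α v ∈ W := by
  obtain ⟨χ, hχ⟩ := hvN
  -- the character matters only through its value at the central element
  have hzc : Metaplectic.zc ∈ Metaplectic.tilde (Gamma0 N) := by
    rw [Metaplectic.mem_tilde_iff, Metaplectic.toSL_zc]
    exact one_mem _
  obtain ⟨n, hNn, hMn, hTn, hsign, htriv⟩ :=
    Metaplectic.exists_level hMN hker (hχ ⟨Metaplectic.zc, hzc⟩)
  have hc : Metaplectic.e α ^ n = 1 := by
    rw [Metaplectic.rho_T_pow hvT] at hTn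
    exact smul_left_injective ℂ hv (by simpa using hTn)
  obtain ⟨A, hA⟩ := (Metaplectic.e_eq_one_iff _).1 ((Metaplectic.e_pow α n).symm.trans hc)
  obtain ⟨k, -, rfl⟩ := (Nat.dvd_prime_pow hp).1 hMp
  have hk : 0 < k := by
    rcases Nat.eq_zero_or_pos k with rfl | hk
    · rw [pow_zero, one_mul] at hM
      rw [hM] at hpM
      exact absurd (Nat.Coprime.eq_one_of_dvd hMs hpM) hp.one_lt.ne'
    · exact hk
  let D := Metaplectic.signedAction hMn hv hvT hc hsign
  have hD : D.OddOrTrivial := htriv.imp id fun h g x hg =>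
    Metaplectic.sgn_signedAction_eq_one hMn hv hvT hc hsign h hg
  have hWD : D.Stable (Ms * n) W := fun g hg w hw =>
    hW g (Metaplectic.mem_tilde_iff.2 (Gamma_mono (mul_dvd_mul_left Ms hNn) hg)) w hw
  have hB : ((b * n + A : ℤ) : ℚ) = (b + α) * n := by
    push_cast
    rw [← hA]
    ring
  let ψ : AddChar (ZMod M) ℂ :=
    AddChar.mulShift ZMod.stdAddChar (-((b * n + A : ℤ) : ZMod M) * (n : ZMod M)⁻¹)
  -- `(b + α) n` is divisible by `p ^ k`, so `ψ` is trivial on the multiples of `Ms`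
  have hψ : p = 2 ∨ p = 3 → ∀ y, ψ (Ms * y) = 1 := fun hp23 y => by
    have hdA := Metaplectic.dvd_of_mul_natCast_eq hA (hα hp23)
    have h0 : (((b * n + A : ℤ) : ZMod M)) * (Ms : ZMod M) = 0 := by
      have : (M : ℤ) ∣ (b * n + A) * Ms := by
        rw [hM]
        push_cast
        push_cast at hb hdA
        exact mul_dvd_mul_right (dvd_add (hb.mul_right _) hdA) _
      exact_mod_cast (ZMod.intCast_zmod_eq_zero_iff_dvd _ M).2 this
    have : -((b * n + A : ℤ) : ZMod M) * (n : ZMod M)⁻¹ * (Ms * y) = 0 := by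
      linear_combination (-(n : ZMod M)⁻¹ * y) * h0
    rw [AddChar.mulShift_apply, this, AddChar.map_zero_eq_one]
  have hS : ∑ x, ψ x • D.F x ∈ W := by
    rw [Metaplectic.vT_eq hMn hvT hB] at hbW
    exact hbW
  obtain ⟨θ, hθ, hθp, hθW⟩ := SignedAction.exists_twist_mem hD hp hM hk hMs hMn hWD hψ hS
  obtain ⟨u, hu, hθu⟩ := Metaplectic.exists_eq_stdAddChar hp hpM hθ hθp
  refine ⟨u, hu, ?_⟩
  generalize M / p = m at hθu ⊢
  have hB' : ((b * n + A + u * m * n : ℤ) : ℚ) = ((b + u * m : ℤ) + α) * n := by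
    push_cast at hB ⊢
    rw [hB]
    ring
  rw [Metaplectic.vT_eq hMn hvT hB']
  refine (congrArg (· ∈ W) (Finset.sum_congr rfl fun x _ => ?_)).mp hθW
  show (ψ x * θ x) • D.F x = _ • D.F x
  congr 1
  rw [hθu, AddChar.mulShift_apply, ← AddChar.map_add_eq_mul]
  congr 1
  have hnn : (n : ZMod M) * (n : ZMod M)⁻¹ = 1 := ZMod.coe_mul_inv_eq_one _ hMn.symm
  push_cast
  linear_combination ((u : ZMod M) * (m : ZMod M) * x) * hnn
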